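/- Let $G$ and $H$ be finite groups, let $X$ be a finite set on which $H$ acts freely (on the left, all point stabilizers trivial), and let $\Phi\colon X\to \mathrm{Aut}(G)\sqcup\mathrm{Hom}(G,H)$ be a map such that (S1) $\Phi(X)\cap\mathrm{Aut}(G)\neq\emptyset$; (S2) $\Phi(X)\cap\mathrm{Hom}(G,H)\neq\emptyset$; (S3) if $A=\langle\Phi(X)\cap\mathrm{Aut}(G)\rangle\leq \mathrm{Aut}(G)$ and $B=\{\mu\circ\alpha : \mu\in\Phi(X)\cap\mathrm{Hom}(G,H),\ \alpha\in A\}$, then $\bigcap_{\lambda\in B}\ker\lambda=\{1\}$. Let the elements of $G\sqcup H$ act on the set $X^*$ of finite words over $X$, fixing the empty word, by the recursive rules $$g(xw)=x\,\Phi(x)(g)(w)\quad(g\in G),\qquad h(xw)=h(x)\,w\quad(h\in H),$$ for $x\in X$, $w\in X^*$, where $\Phi(x)(g)$ acts as an element of $G$ or of $H$ according to whether $\Phi(x)\in\mathrm{Aut}(G)$ or $\Phi(x)\in\mathrm{Hom}(G,H)$. The multispinal group $\mathfrak G$ is the group of permutations of $X^*$ generated by the actions of all elements of $G$ and $H$.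 It is self-similar: for all $g\in\mathfrak G$ and $x\in X$ there are a unique letter $g(x)\in X$ and a unique section $g|_x\in\mathfrak G$ with $g(xw)=g(x)\,g|_x(w)$ for all $w\in X^*$. Let $K$ be a field. The Nekrashevych algebra $\mathcal N_K(\mathfrak G,X)$ is the unital $*$-algebra over $K$ (with $K$-linear involution) generated by $X\cup\mathfrak G$ subject to the relations: the product of $g,h\in\mathfrak G$ in the algebra is their product in $\mathfrak G$, the identity of $\mathfrak G$ is the identity of the algebra, and $g^*=g^{-1}$ for $g\in\mathfrak G$; $gx=g(x)\,g|_x$ for $g\in\mathfrak G$, $x\in X$; $y^*x=\delta_{x,y}$ for $x,y\in X$; and $\sum_{x\in X}xx^*=1$. For a homomorphism $\lambda\colon G\to H$ let $\widetilde\lambda\colon KG\to KH$ be the induced homomorphism of group algebras. Then: 1. $\mathcal N_K(\mathfrak G,X)$ is simple if and only if $\bigcap_{\lambda\in B}\ker\widetilde\lambda=0$. 2. If the characteristic of $K$ does not divide $|G|$, then $\mathcal N_K(\mathfrak G,X)$ is simple if and only if for each irreducible representation $\rho$ of $G$ over the algebraic closure of $K$ there exists $\lambda\in B$ with $\ker\lambda\leq\ker\rho$.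 3. If the characteristic of $K$ divides $|\ker\lambda|$ for every $\lambda\in\Phi(X)\cap\mathrm{Hom}(G,H)$, then $\mathcal N_K(\mathfrak G,X)$ is not simple. -/

import Mathlib

universe u

namespace Multispinal

/-! ### Self-similar groups and their Nekrashevych algebras -/

/-- A group `𝔊` acting on the set `X^*` of words is self-similar if the action is faithful and
length-preserving and for every `g` and every letter `x` there is an element `h` of `𝔊` (the section
`g|_x`) with `g(xw) = g(x) h(w)` for all words `w`. -/
class SelfSimilarGroup (𝔊 X : Type*) [Group 𝔊] [MulAction 𝔊 (List X)] : Prop where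
  faithful : ∀ g h : 𝔊, (∀ w : List X, g • w = h • w) → g = h
  length_smul : ∀ (g : 𝔊) (w : List X), (g • w).length = w.length
  exists_section : ∀ (g : 𝔊) (x : X), ∃ h : 𝔊, ∀ w : List X, g • (x :: w) = g • [x] ++ h • w

/-- The generators of the Nekrashevych algebra: the letters `x`, their adjoints `x^*`, and the
elements `g` of the group (whose adjoints are `g^* = g⁻¹`). -/
inductive Gen (𝔊 X : Type*) : Type _
  | letter (x : X) : Gen 𝔊 X
  | letterStar (x : X) : Gen 𝔊 X
  | elt (g : 𝔊) : Gen 𝔊 X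

open Gen FreeAlgebra in
/-- The defining relations of the Nekrashevych algebra.  The family of relations is closed under the
linear anti-automorphism exchanging `x` with `x^*` and `g` with `g⁻¹`, so that the quotient is
the `*`-algebra with generators `X ∪ 𝔊` and these relations. In `smul_letter` and its adjoint
`letterStar_smul` the hypothesis says exactly that `y = g(x)` and `h = g|_x`; both are determined
by `g` and `x` when the action is self-similar. -/
inductive NekrashevychRel (K 𝔊 X : Type*) [Field K] [Fintype X] [Group 𝔊] [MulAction 𝔊 (List X)] :
    FreeAlgebra K (Gen 𝔊 X) → FreeAlgebra K (Gen 𝔊 X) → Prop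
  | one : NekrashevychRel K 𝔊 X (ι K (elt 1)) 1
  | mul (g h : 𝔊) : NekrashevychRel K 𝔊 X (ι K (elt g) * ι K (elt h)) (ι K (elt (g * h)))
  | smul_letter (g h : 𝔊) (x y : X) (hs : ∀ w : List X, g • (x :: w) = y :: (h • w)) :
      NekrashevychRel K 𝔊 X (ι K (elt g) * ι K (letter x)) (ι K (letter y) * ι K (elt h))
  | letterStar_smul (g h : 𝔊) (x y : X) (hs : ∀ w : List X, g • (x :: w) = y :: (h • w)) :
      NekrashevychRel K 𝔊 X (ι K (letterStar x) * ι K (elt g⁻¹))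
        (ι K (elt h⁻¹) * ι K (letterStar y))
  | star_mul_self (x : X) : NekrashevychRel K 𝔊 X (ι K (letterStar x) * ι K (letter x)) 1
  | star_mul_of_ne (x y : X) (hxy : x ≠ y) :
      NekrashevychRel K 𝔊 X (ι K (letterStar y) * ι K (letter x)) 0
  | sum_mul_star :
      NekrashevychRel K 𝔊 X (∑ x : X, ι K (letter x) * ι K (letterStar x)) 1

/-- The Nekrashevych algebra of the self-similar group `(𝔊, X)` with coefficients in `K`. -/
abbrev NekrashevychAlgebra (K 𝔊 X : Type*) [Field K] [Fintype X] [Group 𝔊] [MulAction 𝔊 (List X)]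
    [SelfSimilarGroup 𝔊 X] : Type _ :=
  RingQuot (NekrashevychRel K 𝔊 X)

/-! ### Multispinal groups -/

section Data

variable {G H X : Type*} [Group G] [Group H] [MulAction H X] (Φ : X → MulAut G ⊕ (G →* H))

/-- `A`, the subgroup of `Aut(G)` generated by `Φ(X) ∩ Aut(G)`. -/
def autSubgroup : Subgroup (MulAut G) :=
  Subgroup.closure {α | ∃ x, Φ x = Sum.inl α}

/-- `B = (Φ(X) ∩ Hom(G,H)) · A`, where `Aut(G)` acts on `Hom(G,H)` by precomposition. -/
def homSet : Set (G →* H) :=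
  {lam | ∃ x μ, ∃ α ∈ autSubgroup Φ, Φ x = Sum.inr μ ∧ lam = μ.comp (α : G ≃* G).toMonoidHom}

/-- The requirements on `Φ` in the data of a multispinal group. -/
structure IsMultispinal : Prop where
  exists_aut : ∃ x α, Φ x = Sum.inl α
  exists_hom : ∃ x μ, Φ x = Sum.inr μ
  iInf_ker : ⨅ lam ∈ homSet Φ, MonoidHom.ker lam = ⊥

/-- The letter `s(x)` for a state `s ∈ G ⊔ H`. -/
def out : G ⊕ H → X → X
  | .inl _, x => x
  | .inr h, x => h • x

/-- The section `s|_x` of a state `s ∈ G ⊔ H`. (The two identities `1_G` and `1_H` are one and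
the same state of the automaton; they act in the same way, as the identity.) -/
def sec : G ⊕ H → X → G ⊕ H
  | .inl g, x => match Φ x with
    | .inl α => .inl (α g)
    | .inr μ => .inr (μ g)
  | .inr _, _ => .inr 1

/-- The action of a state on words. -/
def act : G ⊕ H → List X → List X
  | _, [] => []
  | s, x :: w => out s x :: act (sec Φ s x) w

theorem act_inr_one (w : List X) : act Φ (.inr 1) w = w := by
  induction w with
  | nil => rfl
  | cons x w ih => simp [act, out, sec, ih]

theorem act_inr_inv (h : H) (w : List X) : act Φ (.inr h⁻¹) (act Φ (.inr h) w) = w := by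
  cases w with
  | nil => rfl
  | cons x w => simp [act, out, sec, act_inr_one]

theorem act_inl_inv (g : G) (w : List X) : act Φ (.inl g⁻¹) (act Φ (.inl g) w) = w := by
  induction w generalizing g with
  | nil => rfl
  | cons x w ih =>
    rcases hx : Φ x with α | μ
    · simp [act, out, sec, hx, ih]
    · simp [act, out, sec, hx, act_inr_inv]

/-- The inverse state. -/
def invState : G ⊕ H → G ⊕ H := Sum.map (·⁻¹) (·⁻¹)

theorem act_invState (s : G ⊕ H) (w : List X) : act Φ (invState s) (act Φ s w) = w := by
  cases s with
  | inl g => exact act_inl_inv Φ g w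
  | inr h => exact act_inr_inv Φ h w

theorem invState_invState (s : G ⊕ H) : invState (invState s) = s := by
  cases s <;> simp [invState]

/-- The permutation of the set of words given by a state. -/
def statePerm (s : G ⊕ H) : Equiv.Perm (List X) where
  toFun := act Φ s
  invFun := act Φ (invState s)
  left_inv := act_invState Φ s
  right_inv w := by simpa only [invState_invState] using act_invState Φ (invState s) w

/-- The multispinal group: the automaton group generated by the states. -/
def multispinalGroup : Subgroup (Equiv.Perm (List X)) :=
  Subgroup.closure (Set.range (statePerm Φ))

theorem exists_section_of_mem {g : Equiv.Perm (List X)} (hg : g ∈ multispinalGroup Φ) :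
    g [] = [] ∧ ∀ x, ∃ y, ∃ h ∈ multispinalGroup Φ, ∀ w, g (x :: w) = y :: h w := by
  have key : ∀ s : G ⊕ H, statePerm Φ s [] = [] ∧
      ∀ x, ∃ y, ∃ h ∈ multispinalGroup Φ, ∀ w, statePerm Φ s (x :: w) = y :: h w := fun s =>
    ⟨rfl, fun x => ⟨out s x, statePerm Φ (sec Φ s x), Subgroup.subset_closure ⟨_, rfl⟩,
      fun _ => rfl⟩⟩
  have hinv : ∀ s : G ⊕ H, (statePerm Φ s)⁻¹ = statePerm Φ (invState s) := fun s => by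
    ext1 w
    rfl
  refine Subgroup.closure_induction'' (p := fun g _ => g [] = [] ∧
    ∀ x, ∃ y, ∃ h ∈ multispinalGroup Φ, ∀ w, g (x :: w) = y :: h w) ?_ ?_ ?_ ?_ hg
  · rintro _ ⟨s, rfl⟩
    exact key s
  · rintro _ ⟨s, rfl⟩
    rw [hinv]
    exact key _
  · exact ⟨rfl, fun x => ⟨x, 1, one_mem _, fun _ => rfl⟩⟩
  · rintro a b - - ⟨ha0, ha⟩ ⟨hb0, hb⟩
    refine ⟨by simp [hb0, ha0], fun x => ?_⟩
    obtain ⟨y, k, hk, e⟩ := hb x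
    obtain ⟨z, l, hl, f⟩ := ha y
    exact ⟨z, l * k, mul_mem hl hk, fun w => by simp [e, f]⟩

instance : SelfSimilarGroup (multispinalGroup Φ) X where
  faithful g h hgh := Subtype.ext (Equiv.ext hgh)
  length_smul := by
    suffices ∀ (w : List X) (g : Equiv.Perm (List X)), g ∈ multispinalGroup Φ →
        (g w).length = w.length from fun g w => this w g g.2
    intro w
    induction w with
    | nil =>
      intro g hg
      rw [(exists_section_of_mem Φ hg).1]
    | cons x w ih =>
      intro g hg
      obtain ⟨y, h, hh, e⟩ := (exists_section_of_mem Φ hg).2 x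
      simp [e, ih h hh]
  exists_section g x := by
    obtain ⟨y, h, hh, e⟩ := (exists_section_of_mem Φ g.2).2 x
    refine ⟨⟨h, hh⟩, fun w => ?_⟩
    change g.1 (x :: w) = g.1 [x] ++ h w
    rw [e, e, (exists_section_of_mem Φ hh).1]
    rfl

end Data

end Multispinal

namespace Multispinal

noncomputable section

/-! Everything turns on the ideal of elements of KG killed by every map KG → KH induced from B
(`kerIdeal`). The Nekrashevych algebra is simple exactly when this ideal is zero, and the other two
claims are then statements about group algebras.

Simplicity from a zero ideal. The sections of a product of two states are again states or reduce to
states one letter later, so the elements u s v^*, with s a state, span the algebra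
(`wordSpan_eq_top`). Given a ≠ 0 in an ideal, right multiplication by a suitable long word keeps it
nonzero, removes the adjoints and trivializes the states from H, leaving a combination of elements p
g with g in G (`exists_mul_word_mem_span_inl`). Some λ in B keeps the coefficients from cancelling
after g is replaced by λ(g). This λ occurs as a section at some word u, so multiplying by u x turns
p g into the word p u λ(g)(x). Freeness of H keeps these words distinct for distinct pairs (p,
λ(g)). A nontrivial combination of words generates the unit ideal
(`eq_top_of_linearCombination_word_mem`).

Necessity. The algebra acts on germs of maps w ↦ u g(w) at the constant word x₀x₀x₀⋯. Testing germs
on all finite words, with Φ(x₀) an automorphism, shows that KG embeds (`inlAlgHom_ne_zero`). Testing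
only on powers of x₀ remembers just the infinite image word, and there `kerIdeal` acts as zero
(`rep_inlAlgHom_eq_zero`): an element reaching a letter sent to Hom(G,H) is mapped to 0 in KH, while
on a word without such letters G acts trivially and only the augmentation, which is zero, matters. A
nonzero element of `kerIdeal` therefore lies in the kernel of a representation on a nonzero space,
contradicting simplicity. -/

open scoped Classical in
/-- An indicator with values in a ring, used to state the orthogonality of letters. -/
def delta (R : Type*) [Ring R] {X : Type*} (x y : X) : R := if x = y then 1 else 0

/-- Appending `x^m y` with `x ≠ y` separates words of length at most `m`. -/
theorem eq_of_append_prefix {X : Type*} {x y : X} (hxy : x ≠ y) {m : ℕ} {p q : List X}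
    (hpq : p.length ≤ q.length) (hq : q.length ≤ m)
    (h : p ++ (List.replicate m x ++ [y]) <+: q ++ (List.replicate m x ++ [y])) : p = q := by
  obtain ⟨r, hr⟩ := h
  rw [List.append_assoc] at hr
  obtain ⟨s, rfl⟩ : p <+: q := List.prefix_of_prefix_length_le ⟨_, hr⟩ ⟨_, rfl⟩ hpq
  rw [List.append_assoc, List.append_assoc] at hr
  replace hr := List.append_cancel_left hr
  have hs : s.length ≤ m := by simp at hq; omega
  rcases Nat.eq_zero_or_pos s.length with h0 | h0
  · simp [List.length_eq_zero_iff.1 h0]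
  -- Compare the letters at position m: a nonempty s of length at most m shifts the block of x's so
  -- that it covers this position, where the other side has y.
  · have h1 : (List.replicate m x ++ ([y] ++ r))[m]? = some y := by
      rw [List.getElem?_append_right (by simp)]
      simp
    have h2 : (s ++ (List.replicate m x ++ [y]))[m]? = some x := by
      rw [List.getElem?_append_right hs, List.getElem?_append_left (by simp; omega),
        List.getElem?_replicate, if_pos (by omega)]
    rw [hr, h2] at h1
    exact absurd (Option.some.inj h1) hxy

/-! ### Calculus of words and adjoints in the Nekrashevych algebra -/

section Algebra

variable (K : Type*) {𝔊 X : Type*} [Field K] [Fintype X] [Group 𝔊] [MulAction 𝔊 (List X)]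
  [SelfSimilarGroup 𝔊 X]

variable (𝔊) in
/-- The letter `x` in the Nekrashevych algebra. -/
def letter (x : X) : NekrashevychAlgebra K 𝔊 X :=
  RingQuot.mkAlgHom K (NekrashevychRel K 𝔊 X) (FreeAlgebra.ι K (Gen.letter x))

variable (𝔊) in
/-- The adjoint `x^*` of a letter in the Nekrashevych algebra. -/
def letterStar (x : X) : NekrashevychAlgebra K 𝔊 X :=
  RingQuot.mkAlgHom K (NekrashevychRel K 𝔊 X) (FreeAlgebra.ι K (Gen.letterStar x))

variable (X) in
/-- The group elements in the Nekrashevych algebra. -/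
def elt : 𝔊 →* NekrashevychAlgebra K 𝔊 X where
  toFun g := RingQuot.mkAlgHom K (NekrashevychRel K 𝔊 X) (FreeAlgebra.ι K (Gen.elt g))
  map_one' := by
    rw [RingQuot.mkAlgHom_rel K (NekrashevychRel.one (K := K) (𝔊 := 𝔊) (X := X)), map_one]
  map_mul' g h := by
    rw [← RingQuot.mkAlgHom_rel K (NekrashevychRel.mul (K := K) (X := X) g h), map_mul]

variable {K}

theorem elt_mul_letter {g h : 𝔊} {x y : X} (hs : ∀ w : List X, g • (x :: w) = y :: (h • w)) :
    elt K X g * letter K 𝔊 x = letter K 𝔊 y * elt K X h := by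
  have := RingQuot.mkAlgHom_rel K (NekrashevychRel.smul_letter (K := K) g h x y hs)
  simp only [map_mul] at this
  exact this

theorem letterStar_mul_letter (x y : X) :
    letterStar K 𝔊 y * letter K 𝔊 x = delta _ x y := by
  unfold delta
  split_ifs with h
  · subst h
    have := RingQuot.mkAlgHom_rel K (NekrashevychRel.star_mul_self (K := K) (𝔊 := 𝔊) x)
    simp only [map_mul, map_one] at this
    exact this
  · have := RingQuot.mkAlgHom_rel K (NekrashevychRel.star_mul_of_ne (K := K) (𝔊 := 𝔊) x y h)
    simp only [map_mul, map_zero] at this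
    exact this

variable (K 𝔊 X) in
theorem sum_letter_mul_letterStar : ∑ x : X, letter K 𝔊 x * letterStar K 𝔊 x = 1 := by
  have := RingQuot.mkAlgHom_rel K (NekrashevychRel.sum_mul_star (K := K) (𝔊 := 𝔊) (X := X))
  simp only [map_sum, map_mul, map_one] at this
  exact this

theorem eq_sum_letter (a : NekrashevychAlgebra K 𝔊 X) :
    a = ∑ x : X, a * letter K 𝔊 x * letterStar K 𝔊 x := by
  simp_rw [mul_assoc]
  rw [← Finset.mul_sum, sum_letter_mul_letterStar, mul_one]

/-- Since Σ xx^* = 1, an element killed by all letters on the right is zero. This is what allows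
passing to longer words without losing the element. -/
theorem exists_mul_letter_ne_zero {a : NekrashevychAlgebra K 𝔊 X} (ha : a ≠ 0) :
    ∃ x, a * letter K 𝔊 x ≠ 0 := by
  by_contra! h
  apply ha
  rw [eq_sum_letter a]
  simp [h]

/-- An additive, multiplicative and scalar-closed property which holds for the generators holds on
the whole Nekrashevych algebra. -/
theorem nekrashevych_induction {p : NekrashevychAlgebra K 𝔊 X → Prop}
    (algebraMap : ∀ c : K, p (algebraMap K _ c))
    (letter : ∀ x, p (letter K 𝔊 x)) (letterStar : ∀ x, p (letterStar K 𝔊 x))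
    (elt : ∀ g, p (elt K X g)) (add : ∀ a b, p a → p b → p (a + b))
    (mul : ∀ a b, p a → p b → p (a * b)) (a : NekrashevychAlgebra K 𝔊 X) : p a := by
  obtain ⟨a, rfl⟩ := RingQuot.mkAlgHom_surjective K (NekrashevychRel K 𝔊 X) a
  induction a using FreeAlgebra.induction with
  | grade0 c => simpa only [AlgHom.commutes] using algebraMap c
  | grade1 x =>
    cases x with
    | letter x => exact letter x
    | letterStar x => exact letterStar x
    | elt g => exact elt g
  | mul a b ha hb => simpa only [map_mul] using mul _ _ ha hb
  | add a b ha hb => simpa only [map_add] using add _ _ ha hb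

variable (K 𝔊) in
/-- The product of the letters of a word. -/
def word (u : List X) : NekrashevychAlgebra K 𝔊 X := (u.map (letter K 𝔊)).prod

variable (K 𝔊) in
/-- The adjoint of a word. -/
def wordStar : List X → NekrashevychAlgebra K 𝔊 X
  | [] => 1
  | x :: u => wordStar u * letterStar K 𝔊 x

@[simp] theorem word_nil : word K 𝔊 ([] : List X) = 1 := rfl
@[simp] theorem wordStar_nil : wordStar K 𝔊 ([] : List X) = 1 := rfl
theorem word_cons (x : X) (u : List X) : word K 𝔊 (x :: u) = letter K 𝔊 x * word K 𝔊 u := by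
  simp [word]
theorem word_append (u v : List X) : word K 𝔊 (u ++ v) = word K 𝔊 u * word K 𝔊 v := by
  simp [word]
theorem word_singleton (x : X) : word K 𝔊 [x] = letter K 𝔊 x := by
  simp [word]
theorem wordStar_cons (x : X) (u : List X) :
    wordStar K 𝔊 (x :: u) = wordStar K 𝔊 u * letterStar K 𝔊 x := rfl

theorem wordStar_append (u v : List X) :
    wordStar K 𝔊 (u ++ v) = wordStar K 𝔊 v * wordStar K 𝔊 u := by
  induction u with
  | nil => simp
  | cons x u ih => simp [wordStar_cons, ih, mul_assoc]

/-- The relation for one letter is iterated; once u is exhausted, faithfulness identifies the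
remaining section with h. -/
theorem elt_mul_word {g h : 𝔊} {u v : List X} (hl : u.length = v.length)
    (hs : ∀ w : List X, g • (u ++ w) = v ++ h • w) :
    elt K X g * word K 𝔊 u = word K 𝔊 v * elt K X h := by
  induction u generalizing g v with
  | nil =>
    obtain rfl := List.length_eq_zero_iff.1 hl.symm
    obtain rfl : g = h := SelfSimilarGroup.faithful g h hs
    simp
  | cons x u ih =>
    obtain ⟨y, v, rfl⟩ := List.exists_cons_of_length_eq_add_one hl.symm
    obtain ⟨k, hk⟩ := SelfSimilarGroup.exists_section g x
    obtain ⟨z, hz⟩ := List.length_eq_one_iff.1 (SelfSimilarGroup.length_smul g [x])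
    rw [hz] at hk
    have e : ∀ w : List X, z = y ∧ k • (u ++ w) = v ++ h • w := fun w =>
      List.cons.inj ((hk _).symm.trans (hs w))
    obtain ⟨rfl, -⟩ := e []
    rw [word_cons, word_cons, ← mul_assoc, elt_mul_letter hk, mul_assoc,
      ih (Nat.succ_injective hl) fun w => (e w).2, mul_assoc]

theorem wordStar_cons_mul_word_cons (x y : X) (u v : List X) :
    wordStar K 𝔊 (x :: u) * word K 𝔊 (y :: v) =
      delta _ y x * (wordStar K 𝔊 u * word K 𝔊 v) := by
  rw [wordStar_cons, word_cons, mul_assoc, ← mul_assoc (letterStar K 𝔊 x), letterStar_mul_letter]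
  unfold delta
  split_ifs <;> simp

theorem wordStar_mul_word_append (u v : List X) :
    wordStar K 𝔊 u * word K 𝔊 (u ++ v) = word K 𝔊 v := by
  induction u with
  | nil => simp
  | cons x u ih => simp [wordStar_cons_mul_word_cons, ih, delta]

theorem wordStar_mul_word_eq_zero {u v : List X} (hl : u.length ≤ v.length) (h : ¬ u <+: v) :
    wordStar K 𝔊 u * word K 𝔊 v = 0 := by
  induction u generalizing v with
  | nil => simp at h
  | cons x u ih =>
    cases v with
    | nil => simp at hl
    | cons y v =>
      rw [wordStar_cons_mul_word_cons]
      by_cases hxy : x = y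
      · subst hxy
        rw [ih (by simpa using hl) (by simpa using h), mul_zero]
      · simp [delta, Ne.symm hxy]

theorem exists_mul_word_ne_zero {a : NekrashevychAlgebra K 𝔊 X} (ha : a ≠ 0) (n : ℕ) :
    ∃ v : List X, v.length = n ∧ a * word K 𝔊 v ≠ 0 := by
  induction n with
  | zero => exact ⟨[], rfl, by simpa using ha⟩
  | succ n ih =>
    obtain ⟨v, hv, h⟩ := ih
    obtain ⟨x, hx⟩ := exists_mul_letter_ne_zero h
    exact ⟨v ++ [x], by simp [hv], by rwa [word_append, word_singleton, ← mul_assoc]⟩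

/-- A two-sided ideal containing a nontrivial formal combination of words is everything. -/
theorem eq_top_of_linearCombination_word_mem {x y : X} (hxy : x ≠ y)
    (I : TwoSidedIdeal (NekrashevychAlgebra K 𝔊 X)) {F : List X →₀ K} (hF : F ≠ 0)
    (hI : Finsupp.linearCombination K (word K 𝔊) F ∈ I) : I = ⊤ := by
  -- With p of minimal length, pt is no longer than any qt, so (pt)^* qt vanishes unless pt is a
  -- prefix of qt; the tail t = x^m y forces q = p in that case.
  obtain ⟨p, hp, hmin⟩ := Finset.exists_min_image F.support List.length
    (Finsupp.support_nonempty_iff.2 hF)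
  set m := F.support.sup List.length
  set t := List.replicate m x ++ [y]
  have key : wordStar K 𝔊 (p ++ t) * Finsupp.linearCombination K (word K 𝔊) F * word K 𝔊 t
      = algebraMap K _ (F p) := by
    rw [Finsupp.linearCombination_apply, Finsupp.sum, Finset.mul_sum, Finset.sum_mul,
      Finset.sum_eq_single p]
    · rw [mul_smul_comm, smul_mul_assoc, mul_assoc, ← word_append]
      have := wordStar_mul_word_append (K := K) (𝔊 := 𝔊) (p ++ t) []
      rw [List.append_nil] at this
      rw [this, word_nil, Algebra.algebraMap_eq_smul_one]
    · intro q hq hqp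
      rw [mul_smul_comm, smul_mul_assoc, mul_assoc, ← word_append, wordStar_mul_word_eq_zero,
        smul_zero]
      · simpa using hmin q hq
      · exact fun h => hqp (eq_of_append_prefix hxy (hmin q hq) (Finset.le_sup hq) h).symm
    · exact fun h => absurd hp h
  have h1 : algebraMap K (NekrashevychAlgebra K 𝔊 X) (F p) ∈ I :=
    key ▸ I.mul_mem_right _ _ (I.mul_mem_left _ _ hI)
  have h2 := I.mul_mem_left (algebraMap K _ (F p)⁻¹) _ h1
  rw [← map_mul, inv_mul_cancel₀ (Finsupp.mem_support_iff.1 hp), map_one] at h2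
  exact (TwoSidedIdeal.one_mem_iff I).1 h2

end Algebra

/-! ### Representations on self-similar sets -/

section Representation

variable (K : Type*) {𝔊 X S : Type*} [Field K] [Group 𝔊] [MulAction 𝔊 S]

/-- The action of the generators on the free vector space on a self-similar set. -/
def genAction (c : X × S ≃ S) : Gen 𝔊 X → Module.End K (S →₀ K)
  | .letter x => Finsupp.lmapDomain K K fun s => c (x, s)
  | .letterStar x => Finsupp.linearCombination K fun s =>
      delta K (c.symm s).1 x • Finsupp.single (c.symm s).2 1
  | .elt g => Finsupp.lmapDomain K K fun s => g • s

variable {K}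

theorem genAction_letterStar_single (c : X × S ≃ S) (x y : X) (s : S) (a : K) :
    genAction (𝔊 := 𝔊) K c (.letterStar x) (Finsupp.single (c (y, s)) a) =
      delta K y x • Finsupp.single s a := by
  simp [genAction, mul_comm]

theorem genAction_letter_single (c : X × S ≃ S) (x : X) (s : S) (a : K) :
    genAction (𝔊 := 𝔊) K c (.letter x) (Finsupp.single s a) = Finsupp.single (c (x, s)) a := by
  simp [genAction]

theorem genAction_elt_single (c : X × S ≃ S) (g : 𝔊) (s : S) (a : K) :
    genAction (X := X) K c (.elt g) (Finsupp.single s a) = Finsupp.single (g • s) a := by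
  simp [genAction]

variable (K) [Fintype X] [MulAction 𝔊 (List X)] [SelfSimilarGroup 𝔊 X]

/-- The representation of the Nekrashevych algebra on the free vector space on a self-similar set. -/
def selfSimilarRep (c : X × S ≃ S)
    (hc : ∀ (g h : 𝔊) (x y : X), (∀ w : List X, g • (x :: w) = y :: (h • w)) →
      ∀ s, g • c (x, s) = c (y, h • s)) :
    NekrashevychAlgebra K 𝔊 X →ₐ[K] Module.End K (S →₀ K) :=
  RingQuot.liftAlgHom K ⟨FreeAlgebra.lift K (genAction K c), by
    intro a b hab
    -- Every basis vector has the form c(x, s), so the relations need checking only there.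
    have ext' : ∀ {φ ψ : Module.End K (S →₀ K)},
        (∀ x s, φ (Finsupp.single (c (x, s)) 1) = ψ (Finsupp.single (c (x, s)) 1)) → φ = ψ := by
      intro φ ψ h
      refine Finsupp.lhom_ext' fun s => LinearMap.ext_ring ?_
      obtain ⟨⟨x, s⟩, rfl⟩ := c.surjective s
      exact h x s
    induction hab with
    | one =>
      refine ext' fun z s => ?_
      simp [genAction_elt_single]
    | mul g h =>
      refine ext' fun z s => ?_
      simp [genAction_elt_single, mul_smul]
    | smul_letter g h x y hs =>
      refine ext' fun z s => ?_
      simp [genAction_elt_single, genAction_letter_single, hc g h x y hs]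
    | letterStar_smul g h x y hs =>
      refine ext' fun z s => ?_
      simp only [map_mul, FreeAlgebra.lift_ι_apply, Module.End.mul_apply, genAction_elt_single,
        genAction_letterStar_single, map_smul]
      -- With g⁻¹ c(z, s) = c(x', s'), the letter z is g(x'). The two sides are nonzero when x' = x
      -- and when z = y respectively, and these conditions agree because g is injective on words.
      obtain ⟨⟨x', s'⟩, hx'⟩ := c.surjective (g⁻¹ • c (z, s))
      rw [← hx', genAction_letterStar_single]
      have e : g • c (x', s') = c (z, s) := by rw [hx', smul_inv_smul]
      obtain ⟨h', hh'⟩ := SelfSimilarGroup.exists_section g x'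
      obtain ⟨y', hy'⟩ : ∃ y', g • [x'] = [y'] :=
        List.length_eq_one_iff.1 (SelfSimilarGroup.length_smul g [x'])
      rw [hy'] at hh'
      have e' := hc g h' x' y' hh' s'
      rw [e, c.apply_eq_iff_eq, Prod.mk.injEq] at e'
      obtain ⟨rfl, rfl⟩ := e'
      by_cases hx : x' = x
      · subst hx
        have : z = y ∧ h' = h := by
          have e1 := hh' []
          have e2 := hs []
          rw [e2] at e1
          simp only [List.singleton_append, List.cons.injEq] at e1
          refine ⟨e1.1.symm, SelfSimilarGroup.faithful (X := X) _ _ fun w => ?_⟩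
          have := (hs w).symm.trans (hh' w)
          simp only [List.singleton_append, List.cons.injEq] at this
          exact this.2.symm
        obtain ⟨rfl, rfl⟩ := this
        simp [delta]
      · have : z ≠ y := by
          rintro rfl
          -- This tail is chosen so that the words starting with x and x' have the same image under
          -- g.
          have e1 := hs (h⁻¹ • (h' • []))
          rw [smul_inv_smul] at e1
          have e2 := hh' []
          simp only [List.singleton_append] at e2
          rw [← e2] at e1
          have := smul_left_cancel g e1
          simp only [List.cons.injEq] at this
          exact hx this.1.symm
        simp [delta, hx, this]
    | star_mul_self x =>
      refine ext' fun z s => ?_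
      simp [genAction_letter_single, genAction_letterStar_single, delta]
    | star_mul_of_ne x y hxy =>
      refine ext' fun z s => ?_
      simp [genAction_letter_single, genAction_letterStar_single, delta, hxy]
    | sum_mul_star =>
      refine ext' fun z s => ?_
      simp only [map_sum, map_mul, FreeAlgebra.lift_ι_apply, LinearMap.sum_apply,
        Module.End.mul_apply, genAction_letterStar_single, map_smul, genAction_letter_single,
        map_one, Module.End.one_apply]
      rw [Finset.sum_eq_single z]
      · simp [delta]
      · intro x _ hx
        simp [delta, hx.symm]
      · simp⟩

variable {K}

theorem selfSimilarRep_elt (c : X × S ≃ S)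
    (hc : ∀ (g h : 𝔊) (x y : X), (∀ w : List X, g • (x :: w) = y :: (h • w)) →
      ∀ s, g • c (x, s) = c (y, h • s)) (g : 𝔊) (s : S) (a : K) :
    selfSimilarRep K c hc (elt K X g) (Finsupp.single s a) = Finsupp.single (g • s) a := by
  rw [← genAction_elt_single c g s a]
  simp [selfSimilarRep, elt]

theorem selfSimilarRep_letter (c : X × S ≃ S)
    (hc : ∀ (g h : 𝔊) (x y : X), (∀ w : List X, g • (x :: w) = y :: (h • w)) →
      ∀ s, g • c (x, s) = c (y, h • s)) (x : X) (s : S) (a : K) :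
    selfSimilarRep K c hc (letter K 𝔊 x) (Finsupp.single s a) = Finsupp.single (c (x, s)) a := by
  rw [← genAction_letter_single (𝔊 := 𝔊) c x s a]
  simp [selfSimilarRep, letter]

end Representation

/-! ### Germs -/

section Germs

variable (𝔊 X : Type*) [Group 𝔊] [MulAction 𝔊 (List X)]

/-- The transformations `w ↦ u g(w)` of the set of words. -/
@[ext]
structure Branch where
  /-- The underlying function. -/
  val : List X → List X
  exists_eq : ∃ (u : List X) (g : 𝔊), ∀ w, val w = u ++ g • w

variable {𝔊 X}

namespace Branch

/-- The branch `w ↦ g(w)`. -/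
def ofGroup (g : 𝔊) : Branch 𝔊 X := ⟨fun w => g • w, [], g, fun _ => rfl⟩

/-- Prefixing a letter to a branch. -/
def cons (x : X) (F : Branch 𝔊 X) : Branch 𝔊 X :=
  ⟨fun w => x :: F.val w, by
    obtain ⟨u, g, h⟩ := F.exists_eq
    exact ⟨x :: u, g, fun w => by simp [h]⟩⟩

theorem smul_append_mem [SelfSimilarGroup 𝔊 X] (g : 𝔊) (u : List X) :
    ∃ (v : List X) (h : 𝔊), v.length = u.length ∧ ∀ w, g • (u ++ w) = v ++ h • w := by
  induction u generalizing g with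
  | nil => exact ⟨[], g, rfl, fun w => rfl⟩
  | cons x u ih =>
    obtain ⟨h, hh⟩ := SelfSimilarGroup.exists_section g x
    obtain ⟨v, k, hv, hk⟩ := ih h
    refine ⟨g • [x] ++ v, k, ?_, fun w => ?_⟩
    · simp [SelfSimilarGroup.length_smul, hv, add_comm]
    · rw [List.cons_append, hh, hk, List.append_assoc]

instance [SelfSimilarGroup 𝔊 X] : MulAction 𝔊 (Branch 𝔊 X) where
  smul g F := ⟨fun w => g • F.val w, by
    obtain ⟨u, h, hu⟩ := F.exists_eq
    obtain ⟨v, k, -, hv⟩ := smul_append_mem g u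
    exact ⟨v, k * h, fun w => by rw [hu, hv, mul_smul]⟩⟩
  one_smul F := Branch.ext (funext fun w => one_smul 𝔊 (F.val w))
  mul_smul g h F := Branch.ext (funext fun w => mul_smul g h (F.val w))

theorem smul_val [SelfSimilarGroup 𝔊 X] (g : 𝔊) (F : Branch 𝔊 X) (w : List X) :
    (g • F).1 w = g • F.val w := rfl

/-- A branch either prefixes a letter or does so after consuming one letter. -/
theorem eq_cons_or [SelfSimilarGroup 𝔊 X] (x₀ : X) (F : Branch 𝔊 X) :
    (∃ x F', F = cons x F') ∨
      (F.val [] = [] ∧ ∃ x, ∃ F' : Branch 𝔊 X, ∀ w, F.val (x₀ :: w) = x :: F'.val w) := by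
  obtain ⟨F, u, g, hF⟩ := F
  cases u with
  | cons x u => exact Or.inl ⟨x, ⟨fun w => u ++ g • w, u, g, fun w => rfl⟩, Branch.ext (funext hF)⟩
  | nil =>
    obtain ⟨h, hh⟩ := SelfSimilarGroup.exists_section g x₀
    obtain ⟨y, hy⟩ := List.length_eq_one_iff.1 (SelfSimilarGroup.length_smul g [x₀])
    refine Or.inr ⟨?_, y, ofGroup h, fun w => ?_⟩
    · exact (hF _).trans (List.length_eq_zero_iff.1 (SelfSimilarGroup.length_smul g []))
    · refine (hF _).trans ?_
      rw [hh, hy]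
      rfl

/-- Two branches have the same germ at `x₀ x₀ x₀ ⋯`, as tested by the words of `W`, if they agree
after precomposing with powers of `x₀`. -/
def setoid (x₀ : X) (W : Set (List X)) (hW : ∀ w ∈ W, x₀ :: w ∈ W) : Setoid (Branch 𝔊 X) where
  r F F' := ∃ i j : ℕ, ∀ w ∈ W, F.val (List.replicate i x₀ ++ w) = F'.val (List.replicate j x₀ ++ w)
  iseqv :=
    { refl := fun F => ⟨0, 0, fun w _ => rfl⟩
      symm := fun ⟨i, j, h⟩ => ⟨j, i, fun w hw => (h w hw).symm⟩
      trans := by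
        rintro F F' F'' ⟨i, j, h⟩ ⟨k, l, h'⟩
        have hrep : ∀ n, ∀ w ∈ W, List.replicate n x₀ ++ w ∈ W := by
          intro n w hw
          induction n with
          | zero => exact hw
          | succ n ih => exact hW _ ih
        -- The two comparisons are made to meet at F' precomposed with j + k copies of x₀.
        refine ⟨i + k, l + j, fun w hw => ?_⟩
        rw [List.replicate_add, List.append_assoc, h _ (hrep k w hw), ← List.append_assoc,
          ← List.replicate_add, add_comm j, List.replicate_add, List.append_assoc,
          h' _ (hrep j w hw), ← List.append_assoc, ← List.replicate_add] }

end Branch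

variable (𝔊) in
/-- The set of germs of branches at `x₀ x₀ x₀ ⋯`. -/
def Germ (x₀ : X) (W : Set (List X)) (hW : ∀ w ∈ W, x₀ :: w ∈ W) : Type _ :=
  Quotient (Branch.setoid (𝔊 := 𝔊) x₀ W hW)

namespace Germ

variable {x₀ : X} {W : Set (List X)} {hW : ∀ w ∈ W, x₀ :: w ∈ W}

/-- The germ of a branch. -/
def mk (F : Branch 𝔊 X) : Germ 𝔊 x₀ W hW := Quotient.mk _ F

theorem mk_eq_mk {F F' : Branch 𝔊 X} : (mk F : Germ 𝔊 x₀ W hW) = mk F' ↔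
    ∃ i j : ℕ, ∀ w ∈ W, F.val (List.replicate i x₀ ++ w) = F'.val (List.replicate j x₀ ++ w) :=
  Quotient.eq

theorem mk_surjective (s : Germ 𝔊 x₀ W hW) : ∃ F, mk F = s := Quotient.exists_rep s

theorem mk_eq_mk_cons {F F' : Branch 𝔊 X} {x : X} (h : ∀ w, F.val (x₀ :: w) = x :: F'.val w) :
    (mk F : Germ 𝔊 x₀ W hW) = mk (Branch.cons x F') :=
  mk_eq_mk.2 ⟨1, 0, fun w _ => h w⟩

variable [SelfSimilarGroup 𝔊 X]

instance : MulAction 𝔊 (Germ 𝔊 x₀ W hW) where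
  smul g := Quotient.map (g • ·) fun _ _ ⟨i, j, h⟩ =>
    ⟨i, j, fun w hw => congrArg (g • ·) (h w hw)⟩
  one_smul s := by
    obtain ⟨F, rfl⟩ := mk_surjective s
    exact congrArg mk (one_smul 𝔊 F)
  mul_smul g h s := by
    obtain ⟨F, rfl⟩ := mk_surjective s
    exact congrArg mk (mul_smul g h F)

/-- Every germ is the germ of a branch which prefixes a letter. -/
theorem exists_cons (s : Germ 𝔊 x₀ W hW) : ∃ x F, s = mk (Branch.cons x F) := by
  obtain ⟨F, rfl⟩ := mk_surjective s
  obtain ⟨x, F', rfl⟩ | ⟨-, x, F', h⟩ := Branch.eq_cons_or x₀ F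
  · exact ⟨x, F', rfl⟩
  · exact ⟨x, F', mk_eq_mk_cons h⟩

variable (𝔊 x₀ W hW) in
/-- The bijection which prefixes a letter to a germ. -/
def consEquiv (hne : W.Nonempty) : X × Germ 𝔊 x₀ W hW ≃ Germ 𝔊 x₀ W hW :=
  Equiv.ofBijective
    (fun p => Quotient.map (sa := Branch.setoid x₀ W hW) (sb := Branch.setoid x₀ W hW)
      (Branch.cons p.1)
      (fun _ _ ⟨i, j, h⟩ => ⟨i, j, fun w hw => congrArg (p.1 :: ·) (h w hw)⟩) p.2) <| by
    constructor
    · rintro ⟨x, s⟩ ⟨y, t⟩ h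
      obtain ⟨F, rfl⟩ := mk_surjective s
      obtain ⟨F', rfl⟩ := mk_surjective t
      obtain ⟨i, j, h⟩ := mk_eq_mk.1 h
      obtain ⟨w, hw⟩ := hne
      have := (List.cons.inj (h w hw)).1
      simp only at this
      subst this
      exact Prod.ext rfl (mk_eq_mk.2 ⟨i, j, fun w hw => (List.cons.inj (h w hw)).2⟩)
    · intro s
      obtain ⟨x, F, rfl⟩ := exists_cons s
      exact ⟨(x, mk F), rfl⟩

theorem smul_consEquiv (hne : W.Nonempty) (g h : 𝔊) (x y : X)
    (hs : ∀ w : List X, g • (x :: w) = y :: (h • w)) (s : Germ 𝔊 x₀ W hW) :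
    g • consEquiv 𝔊 x₀ W hW hne (x, s) = consEquiv 𝔊 x₀ W hW hne (y, h • s) := by
  obtain ⟨F, rfl⟩ := mk_surjective s
  exact congrArg mk (Branch.ext (funext fun w => hs (F.val w)))

variable (K : Type*) [Field K] [Fintype X]

variable (𝔊 x₀ W hW) in
/-- The representation of the Nekrashevych algebra on the free vector space on germs. -/
def rep (hne : W.Nonempty) :
    NekrashevychAlgebra K 𝔊 X →ₐ[K] Module.End K (Germ 𝔊 x₀ W hW →₀ K) :=
  selfSimilarRep K (consEquiv 𝔊 x₀ W hW hne) (smul_consEquiv hne)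

theorem rep_elt (hne : W.Nonempty) (g : 𝔊) (s : Germ 𝔊 x₀ W hW) (a : K) :
    rep 𝔊 x₀ W hW K hne (elt K X g) (Finsupp.single s a) = Finsupp.single (g • s) a :=
  selfSimilarRep_elt _ _ g s a

theorem rep_letter (hne : W.Nonempty) (x : X) (F : Branch 𝔊 X) (a : K) :
    rep 𝔊 x₀ W hW K hne (letter K 𝔊 x) (Finsupp.single (mk F) a) =
      Finsupp.single (mk (Branch.cons x F)) a :=
  selfSimilarRep_letter _ _ x (mk F) a

end Germ

end Germs

/-! ### The multispinal group -/

section HomSet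

variable {G H X : Type*} [Group G] [Group H] {Φ : X → MulAut G ⊕ (G →* H)}

/-- Stability of B under precomposition makes `kerIdeal` stable under the automorphisms that its
elements undergo when they pass a letter. -/
theorem comp_mem_homSet {lam : G →* H} (hl : lam ∈ homSet Φ) {x : X} {α : MulAut G}
    (hx : Φ x = .inl α) : lam.comp (α : G ≃* G).toMonoidHom ∈ homSet Φ := by
  obtain ⟨y, μ, β, hβ, hy, rfl⟩ := hl
  exact ⟨y, μ, β * α, mul_mem hβ (Subgroup.subset_closure ⟨x, hx⟩), hy, rfl⟩

theorem mem_homSet {x : X} {μ : G →* H} (hx : Φ x = .inr μ) : μ ∈ homSet Φ :=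
  ⟨x, μ, 1, one_mem _, hx, rfl⟩

variable {K : Type*} [Field K]

variable (Φ K) in
/-- The ideal of `KG` which governs the simplicity of the Nekrashevych algebra. -/
def kerIdeal : Ideal (MonoidAlgebra K G) :=
  ⨅ lam ∈ homSet Φ, RingHom.ker (MonoidAlgebra.mapDomainAlgHom K K lam :
    MonoidAlgebra K G →ₐ[K] MonoidAlgebra K H)

theorem mem_kerIdeal {f : MonoidAlgebra K G} : f ∈ kerIdeal Φ K ↔
    ∀ lam ∈ homSet Φ, MonoidAlgebra.mapDomainAlgHom K K lam f = 0 := by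
  simp [kerIdeal, Submodule.mem_iInf, RingHom.mem_ker]

theorem map_mem_kerIdeal {x : X} {α : MulAut G} (hx : Φ x = .inl α) {f : MonoidAlgebra K G}
    (hf : f ∈ kerIdeal Φ K) :
    MonoidAlgebra.mapDomainAlgHom K K (α : G ≃* G).toMonoidHom f ∈ kerIdeal Φ K := by
  rw [mem_kerIdeal] at hf ⊢
  intro lam hl
  have := hf _ (comp_mem_homSet hl hx)
  rwa [MonoidAlgebra.mapDomainAlgHom_comp] at this

end HomSet

section Group

variable {G H X : Type*} [Group G] [Group H] [MulAction H X] (Φ : X → MulAut G ⊕ (G →* H))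

theorem act_inr_mul (h k : H) (w : List X) :
    act Φ (.inr (h * k)) w = act Φ (.inr h) (act Φ (.inr k) w) := by
  cases w with
  | nil => rfl
  | cons x w => simp [act, out, sec, act_inr_one, mul_smul]

theorem act_inl_mul (g k : G) (w : List X) :
    act Φ (.inl (g * k)) w = act Φ (.inl g) (act Φ (.inl k) w) := by
  induction w generalizing g k with
  | nil => rfl
  | cons x w ih => rcases hx : Φ x with α | μ <;> simp [act, out, sec, hx, ih, act_inr_mul]

/-- A state as an element of the multispinal group. -/
def state (s : G ⊕ H) : multispinalGroup Φ :=
  ⟨statePerm Φ s, Subgroup.subset_closure ⟨s, rfl⟩⟩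

theorem state_smul (s : G ⊕ H) (w : List X) : state Φ s • w = act Φ s w := rfl

theorem state_ext {s t : multispinalGroup Φ} (h : ∀ w : List X, s • w = t • w) : s = t :=
  SelfSimilarGroup.faithful s t h

theorem state_smul_cons (s : G ⊕ H) (x : X) (w : List X) :
    state Φ s • (x :: w) = out s x :: (state Φ (sec Φ s x) • w) := rfl

theorem state_inl_mul (g k : G) :
    state Φ (.inl (g * k)) = state Φ (.inl g) * state Φ (.inl k) :=
  state_ext Φ (act_inl_mul Φ g k)

theorem state_inr_mul (h k : H) :
    state Φ (.inr (h * k)) = state Φ (.inr h) * state Φ (.inr k) :=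
  state_ext Φ (act_inr_mul Φ h k)

theorem state_inr_one : state Φ (.inr 1) = 1 := state_ext Φ (act_inr_one Φ)

theorem state_inl_one : state Φ (.inl 1) = 1 := by
  have := state_inl_mul Φ 1 1
  rwa [mul_one, left_eq_mul] at this

theorem inv_state (s : G ⊕ H) : (state Φ s)⁻¹ = state Φ (invState s) :=
  Subtype.ext (Equiv.ext fun _ => rfl)

/-- The homomorphism from `G` to the multispinal group. -/
def inlHom : G →* multispinalGroup Φ where
  toFun g := state Φ (.inl g)
  map_one' := state_inl_one Φ
  map_mul' := state_inl_mul Φ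

/-- The homomorphism from `H` to the multispinal group. -/
def inrHom : H →* multispinalGroup Φ where
  toFun h := state Φ (.inr h)
  map_one' := state_inr_one Φ
  map_mul' := state_inr_mul Φ

variable {Φ}

/-- An element of `G` fixes the words whose letters are sent to automorphisms. -/
theorem act_inl_eq_self {w : List X} (hw : ∀ x ∈ w, ∃ α, Φ x = .inl α) (g : G) :
    act Φ (.inl g) w = w := by
  induction w generalizing g with
  | nil => rfl
  | cons x w ih =>
    obtain ⟨α, hα⟩ := hw x (by simp)
    simp [act, out, sec, hα, ih fun y hy => hw y (by simp [hy])]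

/-- The automorphisms in `A` are realized by sections at words. -/
theorem exists_word_of_mem_autSubgroup [Finite G] {α : MulAut G} (hα : α ∈ autSubgroup Φ) :
    ∃ u : List X, ∀ (g : G) (w : List X),
      act Φ (.inl g) (u ++ w) = u ++ act Φ (.inl (α g)) w := by
  have : Finite (MulAut G) := Finite.of_injective _ DFunLike.coe_injective
  -- Sections realize only products of the given automorphisms; finiteness of Aut(G) makes their
  -- inverses such products.
  rw [autSubgroup, ← Subgroup.mem_toSubmonoid, Subgroup.closure_toSubmonoid_of_finite] at hα
  induction hα using Submonoid.closure_induction with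
  | mem α h =>
    obtain ⟨x, hx⟩ := h
    exact ⟨[x], fun g w => by simp [act, out, sec, hx]⟩
  | one => exact ⟨[], fun g w => rfl⟩
  | mul α β _ _ iha ihb =>
    obtain ⟨u, hu⟩ := iha
    obtain ⟨v, hv⟩ := ihb
    -- The word read first is applied first, so the word of β precedes that of α.
    exact ⟨v ++ u, fun g w => by simp [hu, hv]⟩

/-- The homomorphisms in `B` are realized by sections at words. -/
theorem exists_word_of_mem_homSet [Finite G] {lam : G →* H} (hl : lam ∈ homSet Φ) :
    ∃ u : List X, ∀ (g : G) (w : List X),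
      act Φ (.inl g) (u ++ w) = u ++ act Φ (.inr (lam g)) w := by
  obtain ⟨x, μ, α, hα, hx, rfl⟩ := hl
  obtain ⟨u, hu⟩ := exists_word_of_mem_autSubgroup hα
  exact ⟨u ++ [x], fun g w => by simp [hu, act, out, sec, hx]⟩

/-- At a word realizing λ ∈ B, one more letter reveals λ(g), because H acts freely. Elements with
equal actions thus differ by an element of every ker λ, and (S3) applies. -/
theorem act_inl_injective [Finite G] (hfree : ∀ (h : H) (x : X), h • x = x → h = 1)
    (hΦ : IsMultispinal Φ) {g k : G} (h : ∀ w, act Φ (.inl g) w = act Φ (.inl k) w) : g = k := by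
  have h1 : g⁻¹ * k ∈ (⊥ : Subgroup G) := by
    rw [← hΦ.iInf_ker]
    simp only [Subgroup.mem_iInf, MonoidHom.mem_ker]
    intro lam hl
    obtain ⟨u, hu⟩ := exists_word_of_mem_homSet hl
    obtain ⟨x, -⟩ := hΦ.exists_aut
    have e := h (u ++ [x])
    rw [hu, hu, List.append_cancel_left_eq] at e
    simp only [act, out, List.cons.injEq, and_true] at e
    apply hfree _ x
    rw [map_mul, map_inv, mul_smul, inv_smul_eq_iff, e]
  exact inv_mul_eq_one.1 (Subgroup.mem_bot.1 h1)

/-- The germs (of infinite words) with a letter which is sent to a homomorphism to `H`. -/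
inductive HasHom (x₀ : X) (W : Set (List X)) (hW : ∀ w ∈ W, x₀ :: w ∈ W) :
    Germ (multispinalGroup Φ) x₀ W hW → Prop
  | hom {x : X} {μ : G →* H} (F : Branch (multispinalGroup Φ) X) (hx : Φ x = .inr μ) :
      HasHom x₀ W hW (.mk (.cons x F))
  | cons (x : X) (F : Branch (multispinalGroup Φ) X) (hF : HasHom x₀ W hW (.mk F)) :
      HasHom x₀ W hW (.mk (.cons x F))

/-- Used contrapositively: without `HasHom`, every F(x₀^n) consists of letters sent to automorphisms
and is fixed by G. The induction peels letters off this finite word, consuming an x₀ whenever the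
branch itself prefixes nothing. -/
theorem hasHom_of_mem {x₀ : X} {W : Set (List X)} {hW : ∀ w ∈ W, x₀ :: w ∈ W}
    (F : Branch (multispinalGroup Φ) X) (n : ℕ) {x : X} {μ : G →* H}
    (hx : x ∈ F.val (List.replicate n x₀)) (hμ : Φ x = .inr μ) : HasHom x₀ W hW (.mk F) := by
  generalize hp : F.val (List.replicate n x₀) = p at hx
  induction p generalizing F n with
  | nil => simp at hx
  | cons y p ih =>
    have main : ∀ (F' : Branch (multispinalGroup Φ) X) (m : ℕ) (z : X),
        z :: F'.val (List.replicate m x₀) = y :: p → HasHom x₀ W hW (.mk (.cons z F')) := by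
      intro F' m z e
      obtain ⟨rfl, e'⟩ := List.cons.inj e
      rcases List.mem_cons.1 hx with rfl | hx
      · exact .hom F' hμ
      · exact .cons _ F' (ih F' m e' hx)
    obtain ⟨z, F', rfl⟩ | ⟨hnil, z, F', h⟩ := Branch.eq_cons_or x₀ F
    · exact main F' n z hp
    · cases n with
      | zero =>
        rw [List.replicate_zero, hnil] at hp
        simp at hp
      | succ n =>
        rw [Germ.mk_eq_mk_cons h]
        exact main F' n z ((h _).symm.trans hp)

end Group

/-! ### The Nekrashevych algebra of a multispinal group -/

section Algebra

variable {G H X : Type*} [Group G] [Group H] [Fintype X] [MulAction H X]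
  {Φ : X → MulAut G ⊕ (G →* H)} (K : Type*) [Field K]

variable (Φ) in
/-- The homomorphism from `KG` to the Nekrashevych algebra. -/
def inlAlgHom : MonoidAlgebra K G →ₐ[K] NekrashevychAlgebra K (multispinalGroup Φ) X :=
  MonoidAlgebra.lift K _ G ((elt K X).comp (inlHom Φ))

variable (Φ) in
/-- The homomorphism from `KH` to the Nekrashevych algebra. -/
def inrAlgHom : MonoidAlgebra K H →ₐ[K] NekrashevychAlgebra K (multispinalGroup Φ) X :=
  MonoidAlgebra.lift K _ H ((elt K X).comp (inrHom Φ))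

variable {K}

theorem elt_state_mul_letter (s : G ⊕ H) (x : X) :
    elt K X (state Φ s) * letter K _ x = letter K _ (out s x) * elt K X (state Φ (sec Φ s x)) :=
  elt_mul_letter (state_smul_cons Φ s x)

theorem inlAlgHom_mul_letter_of_inl {x : X} {α : MulAut G} (hx : Φ x = .inl α)
    (f : MonoidAlgebra K G) :
    inlAlgHom Φ K f * letter K _ x =
      letter K _ x * inlAlgHom Φ K
        (MonoidAlgebra.mapDomainAlgHom K K (α : G ≃* G).toMonoidHom f) := by
  induction f using MonoidAlgebra.induction_linear with
  | zero => simp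
  | add f g hf hg => simp only [map_add, add_mul, mul_add, hf, hg]
  | single g a =>
    have := elt_state_mul_letter (K := K) (Φ := Φ) (.inl g) x
    simp only [out, sec, hx] at this
    simp [inlAlgHom, inlHom, this]

theorem inlAlgHom_mul_letter_of_inr {x : X} {μ : G →* H} (hx : Φ x = .inr μ)
    (f : MonoidAlgebra K G) :
    inlAlgHom Φ K f * letter K _ x =
      letter K _ x * inrAlgHom Φ K (MonoidAlgebra.mapDomainAlgHom K K μ f) := by
  induction f using MonoidAlgebra.induction_linear with
  | zero => simp
  | add f g hf hg => simp only [map_add, add_mul, mul_add, hf, hg]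
  | single g a =>
    have := elt_state_mul_letter (K := K) (Φ := Φ) (.inl g) x
    simp only [out, sec, hx] at this
    simp [inlAlgHom, inlHom, inrAlgHom, inrHom, this]

/-! #### Nontriviality, and elements acting as zero on infinite words -/

/-- The group algebra `KG` embeds into the Nekrashevych algebra, as seen from the germs at the
constant infinite word of a letter which is sent to an automorphism. -/
theorem inlAlgHom_ne_zero [Finite G] (hfree : ∀ (h : H) (x : X), h • x = x → h = 1)
    (hΦ : IsMultispinal Φ) {f : MonoidAlgebra K G} (hf : f ≠ 0) : inlAlgHom Φ K f ≠ 0 := by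
  obtain ⟨x₀, α, hα⟩ := hΦ.exists_aut
  intro h
  have hW : ∀ w ∈ (Set.univ : Set (List X)), x₀ :: w ∈ (Set.univ : Set (List X)) :=
    fun _ _ => Set.mem_univ _
  let s₀ : Germ (multispinalGroup Φ) x₀ Set.univ hW := .mk (.ofGroup 1)
  have h1 : ∀ f : MonoidAlgebra K G,
      Germ.rep _ x₀ Set.univ hW K Set.univ_nonempty (inlAlgHom Φ K f)
        (Finsupp.single s₀ 1) = Finsupp.mapDomain (fun g => state Φ (.inl g) • s₀) f.coeff := by
    intro f
    induction f using MonoidAlgebra.induction_linear with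
    | zero => simp
    | add f g hf hg => simp [hf, hg, Finsupp.mapDomain_add]
    | single g a => simp [inlAlgHom, inlHom, Germ.rep_elt]
  have hinj : Function.Injective fun g : G => state Φ (.inl g) • s₀ := by
    intro g k hgk
    obtain ⟨i, j, hij⟩ := Germ.mk_eq_mk.1 hgk
    have hval : ∀ (g : G) (w : List X),
        (state Φ (.inl g) • (Branch.ofGroup 1 : Branch (multispinalGroup Φ) X)).val w =
          act Φ (.inl g) w := fun g w => by
      rw [Branch.smul_val]
      exact congrArg _ (one_smul _ w)
    simp only [hval] at hij
    have hrep : ∀ (n : ℕ) (g : G) (w : List X), act Φ (.inl g) (List.replicate n x₀ ++ w) =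
        List.replicate n x₀ ++ act Φ (.inl ((α ^ n) g)) w := by
      intro n
      induction n with
      | zero => intro g w; rfl
      | succ n ih =>
        intro g w
        rw [List.replicate_succ, List.cons_append, act, out, sec, hα, pow_succ]
        simp only [ih]
        rfl
    simp only [hrep] at hij
    -- The empty test word compares lengths only.
    have hlen : i = j := by
      have := congrArg List.length (hij [] trivial)
      simpa [act] using this
    subst hlen
    exact (α ^ i).injective (act_inl_injective hfree hΦ fun w =>
      List.append_cancel_left (hij w trivial))
  have h2 := h1 f
  rw [h, map_zero, LinearMap.zero_apply] at h2
  have h3 := Finsupp.mapDomain_injective hinj (h2.symm.trans Finsupp.mapDomain_zero.symm)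
  exact hf (MonoidAlgebra.coeff_eq_zero.1 h3)

/-- The elements of the ideal act as zero on infinite words. -/
theorem rep_inlAlgHom_eq_zero (hΦ : IsMultispinal Φ) (x₀ : X) {W : Set (List X)}
    (hW : ∀ w ∈ W, x₀ :: w ∈ W) (hne : W.Nonempty) (hW' : ∀ w ∈ W, ∃ n, w = List.replicate n x₀)
    {f : MonoidAlgebra K G} (hf : f ∈ kerIdeal Φ K) :
    Germ.rep _ x₀ W hW K hne (inlAlgHom Φ K f) = 0 := by
  refine Finsupp.lhom_ext' fun s => LinearMap.ext_ring ?_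
  change Germ.rep _ x₀ W hW K hne (inlAlgHom Φ K f) (Finsupp.single s 1) = 0
  have hom : ∀ {x : X} {μ : G →* H} (F : Branch (multispinalGroup Φ) X) (_ : Φ x = .inr μ)
      {f : MonoidAlgebra K G} (_ : f ∈ kerIdeal Φ K),
      Germ.rep _ x₀ W hW K hne (inlAlgHom Φ K f) (Finsupp.single (.mk (.cons x F)) 1) = 0 := by
    intro x μ F hx f hf
    rw [← Germ.rep_letter K hne, ← Module.End.mul_apply, ← map_mul, inlAlgHom_mul_letter_of_inr hx,
      mem_kerIdeal.1 hf μ (mem_homSet hx), map_zero, mul_zero, map_zero, LinearMap.zero_apply]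
  by_cases hs : HasHom x₀ W hW s
  · induction hs generalizing f with
    | hom F hx => exact hom F hx hf
    | cons x F hF ih =>
      rcases hx : Φ x with α | μ
      · rw [← Germ.rep_letter K hne, ← Module.End.mul_apply, ← map_mul, inlAlgHom_mul_letter_of_inl hx,
          map_mul, Module.End.mul_apply, ih (map_mem_kerIdeal hx hf), map_zero]
      · exact hom F hx hf
  · have hfix : ∀ g : G, state Φ (.inl g) • s = s := by
      intro g
      obtain ⟨F, rfl⟩ := Germ.mk_surjective s
      refine Germ.mk_eq_mk.2 ⟨0, 0, fun w hw => ?_⟩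
      obtain ⟨n, rfl⟩ := hW' w hw
      refine act_inl_eq_self (fun x hx => ?_) g
      rcases h : Φ x with α | μ
      · exact ⟨α, rfl⟩
      · exact absurd (hasHom_of_mem F n hx h) hs
    obtain ⟨x, μ, hx⟩ := hΦ.exists_hom
    -- The augmentation of KG factors through KH by any μ in Φ(X) ∩ Hom(G,H), which kills f.
    have haug : MonoidAlgebra.lift K K G 1 f = 0 := by
      have : (MonoidAlgebra.lift K K G 1 : MonoidAlgebra K G →ₐ[K] K) =
          (MonoidAlgebra.lift K K H 1).comp (MonoidAlgebra.mapDomainAlgHom K K μ) := by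
        ext; simp
      rw [this, AlgHom.comp_apply, mem_kerIdeal.1 hf μ (mem_homSet hx), map_zero]
    have h1 : ∀ f : MonoidAlgebra K G,
        Germ.rep _ x₀ W hW K hne (inlAlgHom Φ K f) (Finsupp.single s 1) =
          Finsupp.single s (MonoidAlgebra.lift K K G 1 f) := by
      intro f
      induction f using MonoidAlgebra.induction_linear with
      | zero => simp
      | add f g hf hg => simp [hf, hg]
      | single g a => simp [inlAlgHom, inlHom, Germ.rep_elt, hfix]
    rw [h1, haug, Finsupp.single_zero]

theorem nontrivial_nekrashevychAlgebra [Finite G]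
    (hfree : ∀ (h : H) (x : X), h • x = x → h = 1) (hΦ : IsMultispinal Φ) :
    Nontrivial (NekrashevychAlgebra K (multispinalGroup Φ) X) :=
  ⟨⟨_, _, inlAlgHom_ne_zero hfree hΦ (one_ne_zero (α := MonoidAlgebra K G))⟩⟩

theorem kerIdeal_eq_bot_of_isSimpleRing [Finite G]
    (hfree : ∀ (h : H) (x : X), h • x = x → h = 1) (hΦ : IsMultispinal Φ)
    (h : IsSimpleRing (NekrashevychAlgebra K (multispinalGroup Φ) X)) : kerIdeal Φ K = ⊥ := by
  rw [eq_bot_iff]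
  intro f hf
  rw [Submodule.mem_bot]
  by_contra hf0
  obtain ⟨x₀, -⟩ := hΦ.exists_aut
  let W : Set (List X) := Set.range fun n => List.replicate n x₀
  have hW : ∀ w ∈ W, x₀ :: w ∈ W := by
    rintro _ ⟨n, rfl⟩
    exact ⟨n + 1, rfl⟩
  have hne : W.Nonempty := ⟨_, 0, rfl⟩
  have h0 := rep_inlAlgHom_eq_zero hΦ x₀ hW hne (fun w ⟨n, hn⟩ => ⟨n, hn.symm⟩) hf
  have : Nonempty (Germ (multispinalGroup Φ) x₀ W hW) := ⟨.mk (.ofGroup 1)⟩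
  exact inlAlgHom_ne_zero hfree hΦ hf0
    ((Germ.rep _ x₀ W hW K hne).toRingHom.injective (h0.trans (map_zero _).symm))

end Algebra

/-! ### Separating formal combinations of pairs by homomorphisms in B -/

section Curry

theorem curry_zero_apply {ι M K : Type*} [Field K] (i : ι) : (0 : ι × M →₀ K).curry i = 0 := by
  ext
  simp [Finsupp.curry_apply]

theorem curry_add_apply {ι M K : Type*} [Field K] (f g : ι × M →₀ K) (i : ι) :
    (f + g).curry i = f.curry i + g.curry i := by
  ext
  simp [Finsupp.curry_apply]

variable {G H X : Type*} [Group G] [Group H] {Φ : X → MulAut G ⊕ (G →* H)} {K : Type*} [Field K]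

/-- If every λ in B killed f, each slice of f at an index i would be an element of KG lying in
`kerIdeal`, hence zero. -/
theorem exists_mapDomain_ne_zero (h : kerIdeal Φ K = ⊥) {ι : Type*} {f : ι × G →₀ K}
    (hf : f ≠ 0) : ∃ lam ∈ homSet Φ, Finsupp.mapDomain (Prod.map id lam) f ≠ 0 := by
  by_contra! hall
  apply hf
  have hcurry : ∀ (lam : G →* H) (i : ι) (f : ι × G →₀ K),
      (Finsupp.mapDomain (Prod.map id lam) f).curry i = Finsupp.mapDomain lam (f.curry i) := by
    intro lam i f
    classical
    induction f using Finsupp.induction_linear with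
    | zero => simp [curry_zero_apply]
    | add f g hf hg => simp [Finsupp.mapDomain_add, curry_add_apply, hf, hg]
    | single p c =>
      obtain ⟨j, g⟩ := p
      by_cases hij : j = i
      · subst hij
        simp
      · simp [hij]
  have h0 : ∀ i, f.curry i = 0 := by
    intro i
    have : MonoidAlgebra.ofCoeff (f.curry i) ∈ kerIdeal Φ K := by
      rw [mem_kerIdeal]
      intro lam hl
      apply MonoidAlgebra.coeff_injective
      change Finsupp.mapDomain lam (f.curry i) = 0
      rw [← hcurry, hall lam hl, curry_zero_apply]
    rw [h] at this
    exact congrArg MonoidAlgebra.coeff ((Submodule.mem_bot _).1 this)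
  ext ⟨i, g⟩
  exact DFunLike.congr_fun (h0 i) g

end Curry

/-! ### Spanning by words and states, and the sufficient condition for simplicity -/

section Simplicity

variable {G H X : Type*} [Group G] [Group H] [Fintype X] [MulAction H X]
  {Φ : X → MulAut G ⊕ (G →* H)} {K : Type*} [Field K]

variable (Φ K) in
/-- The image of a state in the Nekrashevych algebra. -/
abbrev stateElt (s : G ⊕ H) : NekrashevychAlgebra K (multispinalGroup Φ) X :=
  elt K X (state Φ s)

theorem stateElt_inr_one : stateElt Φ K (.inr 1) = 1 := by
  rw [stateElt, state_inr_one, map_one]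

theorem stateElt_inl_one : stateElt Φ K (.inl 1) = 1 := by
  rw [stateElt, state_inl_one, map_one]

theorem stateElt_mul_letter (s : G ⊕ H) (x : X) :
    stateElt Φ K s * letter K _ x = letter K _ (out s x) * stateElt Φ K (sec Φ s x) :=
  elt_state_mul_letter s x

variable (Φ K) in
/-- The span of the elements `u s v^*` with `s` a state. -/
def wordSpan : Submodule K (NekrashevychAlgebra K (multispinalGroup Φ) X) :=
  Submodule.span K (Set.range fun p : List X × (G ⊕ H) × List X =>
    word K _ p.1 * stateElt Φ K p.2.1 * wordStar K _ p.2.2)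

theorem mem_wordSpan (u : List X) (s : G ⊕ H) (v : List X) :
    word K _ u * stateElt Φ K s * wordStar K _ v ∈ wordSpan Φ K :=
  Submodule.subset_span ⟨(u, s, v), rfl⟩

theorem stateElt_mul_wordStar_mem (s : G ⊕ H) (v : List X) :
    stateElt Φ K s * wordStar K _ v ∈ wordSpan Φ K := by
  simpa using mem_wordSpan (Φ := Φ) (K := K) [] s v

theorem mul_mem_wordSpan {a : NekrashevychAlgebra K (multispinalGroup Φ) X}
    (ha : ∀ u s v, a * (word K _ u * stateElt Φ K s * wordStar K _ v) ∈ wordSpan Φ K)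
    {b : NekrashevychAlgebra K (multispinalGroup Φ) X} (hb : b ∈ wordSpan Φ K) :
    a * b ∈ wordSpan Φ K := by
  induction hb using Submodule.span_induction with
  | mem b hb =>
    obtain ⟨⟨u, s, v⟩, rfl⟩ := hb
    exact ha u s v
  | zero => simp
  | add b c _ _ hb hc => rw [mul_add]; exact add_mem hb hc
  | smul c b _ hb => rw [mul_smul_comm]; exact Submodule.smul_mem _ c hb

theorem letter_mul_mem_wordSpan (x : X) {b : NekrashevychAlgebra K (multispinalGroup Φ) X}
    (hb : b ∈ wordSpan Φ K) : letter K _ x * b ∈ wordSpan Φ K := by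
  refine mul_mem_wordSpan (fun u s v => ?_) hb
  rw [← mul_assoc, ← mul_assoc, ← word_cons]
  exact mem_wordSpan _ _ _

theorem stateElt_mul_stateElt_mem_wordSpan (s t : G ⊕ H) (v : List X) :
    stateElt Φ K s * (stateElt Φ K t * wordStar K _ v) ∈ wordSpan Φ K := by
  -- A product of a state from G and one from H need not be a state. Its sections at letters are,
  -- because the section of the factor from H is trivial, so expanding along Σ xx^* = 1 suffices.
  have mixed : (∀ x, sec Φ t x = .inr 1 ∨ sec Φ s (out t x) = .inr 1) →
      stateElt Φ K s * (stateElt Φ K t * wordStar K _ v) ∈ wordSpan Φ K := by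
    intro h
    rw [← mul_assoc, eq_sum_letter (stateElt Φ K s * stateElt Φ K t), Finset.sum_mul]
    refine Submodule.sum_mem _ fun x _ => ?_
    have hw : wordStar K (multispinalGroup Φ) (v ++ [x]) = letterStar K _ x * wordStar K _ v := by
      rw [wordStar_append, wordStar_cons, wordStar_nil, one_mul]
    rw [mul_assoc (stateElt Φ K s), stateElt_mul_letter, ← mul_assoc, stateElt_mul_letter,
      mul_assoc, ← hw, mul_assoc, mul_assoc]
    apply letter_mul_mem_wordSpan
    obtain h | h := h x <;> rw [h, stateElt_inr_one, one_mul]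
    all_goals exact stateElt_mul_wordStar_mem _ _
  cases s with
  | inl g =>
    cases t with
    | inl k =>
      rw [← mul_assoc, stateElt, stateElt, ← map_mul, ← state_inl_mul]
      exact stateElt_mul_wordStar_mem _ _
    | inr k => exact mixed fun x => Or.inl rfl
  | inr h =>
    cases t with
    | inl k => exact mixed fun x => Or.inr rfl
    | inr k =>
      rw [← mul_assoc, stateElt, stateElt, ← map_mul, ← state_inr_mul]
      exact stateElt_mul_wordStar_mem _ _

theorem stateElt_mul_mem_wordSpan (s : G ⊕ H)
    {b : NekrashevychAlgebra K (multispinalGroup Φ) X} (hb : b ∈ wordSpan Φ K) :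
    stateElt Φ K s * b ∈ wordSpan Φ K := by
  refine mul_mem_wordSpan (fun u t v => ?_) hb
  induction u generalizing s with
  | nil =>
    rw [word_nil, one_mul]
    exact stateElt_mul_stateElt_mem_wordSpan s t v
  | cons x u ih =>
    rw [word_cons, mul_assoc, mul_assoc, ← mul_assoc (stateElt Φ K s), stateElt_mul_letter,
      mul_assoc, ← mul_assoc (word K _ u)]
    exact letter_mul_mem_wordSpan _ (ih _)

theorem elt_mul_mem_wordSpan (g : multispinalGroup Φ)
    {b : NekrashevychAlgebra K (multispinalGroup Φ) X} (hb : b ∈ wordSpan Φ K) :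
    elt K X g * b ∈ wordSpan Φ K := by
  obtain ⟨g, hg⟩ := g
  induction hg using Subgroup.closure_induction'' generalizing b with
  | mem g h =>
    obtain ⟨s, rfl⟩ := h
    exact stateElt_mul_mem_wordSpan s hb
  | inv_mem g h =>
    obtain ⟨s, rfl⟩ := h
    have := stateElt_mul_mem_wordSpan (invState s) hb
    rw [stateElt, ← inv_state] at this
    exact this
  | one =>
    have : elt K X (1 : multispinalGroup Φ) * b ∈ wordSpan Φ K := by simpa using hb
    exact this
  | mul g k hg hk ihg ihk =>
    have : elt K X ((⟨g, hg⟩ : multispinalGroup Φ) * ⟨k, hk⟩) * b ∈ wordSpan Φ K := by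
      rw [map_mul, mul_assoc]
      exact ihg (ihk hb)
    exact this

theorem letterStar_mul_mem_wordSpan (x : X) {b : NekrashevychAlgebra K (multispinalGroup Φ) X}
    (hb : b ∈ wordSpan Φ K) : letterStar K _ x * b ∈ wordSpan Φ K := by
  have hdelta : ∀ (y z : X) {c : NekrashevychAlgebra K (multispinalGroup Φ) X},
      c ∈ wordSpan Φ K → delta _ y z * c ∈ wordSpan Φ K := by
    intro y z c hc
    unfold delta
    split_ifs <;> simp [hc]
  refine mul_mem_wordSpan (fun u s v => ?_) hb
  cases u with
  | nil =>
    rw [word_nil, one_mul, eq_sum_letter (stateElt Φ K s), Finset.sum_mul, Finset.mul_sum]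
    refine Submodule.sum_mem _ fun y _ => ?_
    have hw : wordStar K (multispinalGroup Φ) (v ++ [y]) = letterStar K _ y * wordStar K _ v := by
      rw [wordStar_append, wordStar_cons, wordStar_nil, one_mul]
    rw [stateElt_mul_letter, mul_assoc, ← hw, mul_assoc, ← mul_assoc, letterStar_mul_letter]
    exact hdelta _ _ (stateElt_mul_wordStar_mem _ _)
  | cons y u =>
    rw [word_cons, mul_assoc, mul_assoc, ← mul_assoc, letterStar_mul_letter, ← mul_assoc (word K _ u)]
    exact hdelta _ _ (mem_wordSpan _ _ _)

variable (Φ K) in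
/-- The Nekrashevych algebra of a multispinal group is spanned by the elements `u s v^*`. -/
theorem wordSpan_eq_top : wordSpan Φ K = ⊤ := by
  have h : ∀ a b : NekrashevychAlgebra K (multispinalGroup Φ) X, b ∈ wordSpan Φ K →
      a * b ∈ wordSpan Φ K := by
    intro a
    induction a using nekrashevych_induction with
    | algebraMap c =>
      intro b hb
      rw [← Algebra.smul_def]
      exact Submodule.smul_mem _ c hb
    | letter x => exact fun b => letter_mul_mem_wordSpan x
    | letterStar x => exact fun b => letterStar_mul_mem_wordSpan x
    | elt g => exact fun b => elt_mul_mem_wordSpan g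
    | add a a' ha ha' =>
      intro b hb
      rw [add_mul]
      exact add_mem (ha b hb) (ha' b hb)
    | mul a a' ha ha' =>
      intro b hb
      rw [mul_assoc]
      exact ha _ (ha' b hb)
  rw [Submodule.eq_top_iff']
  intro a
  have h1 : (1 : NekrashevychAlgebra K (multispinalGroup Φ) X) ∈ wordSpan Φ K := by
    simpa [stateElt_inr_one] using mem_wordSpan (Φ := Φ) (K := K) [] (.inr 1) []
  simpa using h a 1 h1

theorem exists_stateElt_mul_word (s : G ⊕ H) (v : List X) :
    ∃ v' t, stateElt Φ K s * word K _ v = word K _ v' * stateElt Φ K t := by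
  induction v generalizing s with
  | nil => exact ⟨[], s, by simp⟩
  | cons x v ih =>
    obtain ⟨v', t, h⟩ := ih (sec Φ s x)
    exact ⟨out s x :: v', t, by
      rw [word_cons, ← mul_assoc, stateElt_mul_letter, mul_assoc, h, word_cons, mul_assoc]⟩

/-- Multiplying by long words on the right removes the adjoints. -/
theorem exists_mul_word_mem_span (a : NekrashevychAlgebra K (multispinalGroup Φ) X) :
    ∃ n : ℕ, ∀ v : List X, n ≤ v.length → a * word K _ v ∈
      Submodule.span K (Set.range fun p : List X × (G ⊕ H) =>
        word K _ p.1 * stateElt Φ K p.2) := by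
  have ha : a ∈ wordSpan Φ K := wordSpan_eq_top Φ K ▸ Submodule.mem_top
  induction ha using Submodule.span_induction with
  | mem a ha =>
    obtain ⟨⟨u, s, v'⟩, rfl⟩ := ha
    refine ⟨v'.length, fun v hv => ?_⟩
    by_cases h : v' <+: v
    · obtain ⟨w, rfl⟩ := h
      obtain ⟨w', t, hw⟩ := exists_stateElt_mul_word (Φ := Φ) (K := K) s w
      simp only
      rw [mul_assoc, wordStar_mul_word_append, mul_assoc, hw, ← mul_assoc, ← word_append]
      exact Submodule.subset_span ⟨(u ++ w', t), rfl⟩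
    · simp only
      rw [mul_assoc, wordStar_mul_word_eq_zero hv h, mul_zero]
      exact zero_mem _
  | zero => exact ⟨0, by simp⟩
  | add a b _ _ ha hb =>
    obtain ⟨n, hn⟩ := ha
    obtain ⟨m, hm⟩ := hb
    refine ⟨max n m, fun v hv => ?_⟩
    rw [add_mul]
    exact add_mem (hn v ((le_max_left _ _).trans hv)) (hm v ((le_max_right _ _).trans hv))
  | smul c a _ ha =>
    obtain ⟨n, hn⟩ := ha
    exact ⟨n, fun v hv => by rw [smul_mul_assoc]; exact Submodule.smul_mem _ c (hn v hv)⟩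

/-- One further letter sent to an automorphism keeps states from G in G and trivializes those from
H. If the letter is sent to a homomorphism, all states land in H and a second letter makes them
trivial. -/
theorem exists_mul_word_mem_span_inl {a : NekrashevychAlgebra K (multispinalGroup Φ) X}
    (ha : a ≠ 0) : ∃ v : List X, a * word K _ v ≠ 0 ∧ a * word K _ v ∈
      Submodule.span K (Set.range fun p : List X × G =>
        word K _ p.1 * stateElt Φ K (.inl p.2)) := by
  obtain ⟨n, hn⟩ := exists_mul_word_mem_span a
  obtain ⟨v, hv, hne⟩ := exists_mul_word_ne_zero ha n
  have hmem := hn v hv.ge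
  obtain ⟨x, hx⟩ := exists_mul_letter_ne_zero hne
  obtain ⟨y, hy⟩ := exists_mul_letter_ne_zero hx
  have hword : ∀ u : List X, word K (multispinalGroup Φ) u ∈
      Submodule.span K (Set.range fun p : List X × G =>
        word K (multispinalGroup Φ) p.1 * stateElt Φ K (.inl p.2)) := fun u =>
    Submodule.subset_span ⟨(u, 1), by simp only [stateElt_inl_one, mul_one]⟩
  rcases hΦx : Φ x with α | μ
  · refine ⟨v ++ [x], by rwa [word_append, word_singleton, ← mul_assoc], ?_⟩
    rw [word_append, word_singleton, ← mul_assoc]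
    generalize a * word K _ v = b at hmem
    induction hmem using Submodule.span_induction with
    | mem b hb =>
      obtain ⟨⟨u, s⟩, rfl⟩ := hb
      simp only
      rw [mul_assoc, stateElt_mul_letter, ← mul_assoc, ← word_singleton, ← word_append]
      cases s with
      | inl g =>
        refine Submodule.subset_span ⟨(u ++ [x], α g), ?_⟩
        simp only [out, sec, hΦx]
      | inr h =>
        rw [sec, stateElt_inr_one, mul_one]
        exact hword _
    | zero => simp
    | add b c _ _ hb hc => rw [add_mul]; exact add_mem hb hc
    | smul c b _ hb => rw [smul_mul_assoc]; exact Submodule.smul_mem _ c hb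
  · refine ⟨v ++ [x] ++ [y], by
      rwa [word_append, word_append, word_singleton, word_singleton, ← mul_assoc, ← mul_assoc], ?_⟩
    rw [word_append, word_append, word_singleton, word_singleton, ← mul_assoc, ← mul_assoc]
    generalize a * word K _ v = b at hmem
    induction hmem using Submodule.span_induction with
    | mem b hb =>
      obtain ⟨⟨u, s⟩, rfl⟩ := hb
      have hs : ∃ h, sec Φ s x = .inr h := by
        cases s with
        | inl g => exact ⟨μ g, by simp only [sec, hΦx]⟩
        | inr h => exact ⟨1, rfl⟩
      obtain ⟨h, hs⟩ := hs
      simp only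
      rw [mul_assoc (word K _ u), stateElt_mul_letter, hs, mul_assoc, mul_assoc,
        stateElt_mul_letter, sec, stateElt_inr_one, mul_one, ← word_singleton, ← word_singleton,
        ← word_append, ← word_append]
      exact hword _
    | zero => simp
    | add b c _ _ hb hc => rw [add_mul, add_mul]; exact add_mem hb hc
    | smul c b _ hb => rw [smul_mul_assoc, smul_mul_assoc]; exact Submodule.smul_mem _ c hb

theorem isSimpleRing_of_kerIdeal_eq_bot [Finite G]
    (hfree : ∀ (h : H) (x : X), h • x = x → h = 1) (hΦ : IsMultispinal Φ)
    (h : kerIdeal Φ K = ⊥) :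
    IsSimpleRing (NekrashevychAlgebra K (multispinalGroup Φ) X) := by
  have := nontrivial_nekrashevychAlgebra (K := K) hfree hΦ
  refine IsSimpleRing.of_eq_bot_or_eq_top fun I => or_iff_not_imp_left.2 fun hI => ?_
  obtain ⟨a, haI, ha⟩ : ∃ a ∈ I, a ≠ 0 := by
    by_contra! hcon
    exact hI (eq_bot_iff.2 fun a ha => (TwoSidedIdeal.mem_bot _).2 (hcon a ha))
  obtain ⟨v, hne, hmem⟩ := exists_mul_word_mem_span_inl ha
  obtain ⟨f, hf⟩ := Finsupp.mem_span_range_iff_exists_finsupp.1 hmem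
  have hf0 : f ≠ 0 := by
    rintro rfl
    exact hne (by rw [← hf, Finsupp.sum_zero_index])
  obtain ⟨x, α, hx⟩ := hΦ.exists_aut
  obtain ⟨y, μ, hy⟩ := hΦ.exists_hom
  have hxy : x ≠ y := by
    rintro rfl
    simp [hx] at hy
  obtain ⟨lam, hl, hlam⟩ := exists_mapDomain_ne_zero h hf0
  obtain ⟨u, hu⟩ := exists_word_of_mem_homSet hl
  have hstate : ∀ g : G, stateElt Φ K (.inl g) * word K _ (u ++ [x]) =
      word K _ (u ++ [lam g • x]) := by
    intro g
    rw [elt_mul_word (h := 1) (v := u ++ [lam g • x]) (by simp), map_one, mul_one]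
    intro w
    rw [state_smul, List.append_assoc, hu, one_smul]
    simp [act, out, sec, act_inr_one]
  let ψ : List X × H → List X := fun p => p.1 ++ (u ++ [p.2 • x])
  -- The appended suffix has constant length, so p is recovered; k is then recovered from k • x by
  -- freeness.
  have hψ : Function.Injective ψ := by
    rintro ⟨p, k⟩ ⟨p', k'⟩ e
    obtain ⟨rfl, e⟩ := List.append_inj' e (by simp)
    have e' : k • x = k' • x := by simpa using e
    have := hfree (k⁻¹ * k') x (by rw [mul_smul, ← e', inv_smul_smul])
    rw [inv_mul_eq_one.1 this]
  refine eq_top_of_linearCombination_word_mem hxy I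
    (F := Finsupp.mapDomain ψ (Finsupp.mapDomain (Prod.map id lam) f)) ?_ ?_
  · exact fun h0 => hlam (Finsupp.mapDomain_injective hψ (h0.trans Finsupp.mapDomain_zero.symm))
  · have key : Finsupp.linearCombination K (word K (multispinalGroup Φ))
        (Finsupp.mapDomain ψ (Finsupp.mapDomain (Prod.map id lam) f)) =
        a * word K _ v * word K _ (u ++ [x]) := by
      rw [Finsupp.linearCombination_mapDomain, Finsupp.linearCombination_mapDomain, ← hf,
        Finsupp.linearCombination_apply, Finsupp.sum, Finsupp.sum, Finset.sum_mul]
      refine Finset.sum_congr rfl fun p _ => ?_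
      rw [smul_mul_assoc, mul_assoc, hstate, ← word_append]
      rfl
    rw [key]
    exact I.mul_mem_right _ _ (I.mul_mem_right _ _ haI)

end Simplicity

end

end Multispinal

namespace Multispinal

/-! ### Representation theory of `G` -/

section Representation

/-- Extension of scalars for group algebras. -/
noncomputable def extendScalars (K L G : Type*) [Field K] [Field L] [Algebra K L] [Group G] :
    MonoidAlgebra K G →ₐ[K] MonoidAlgebra L G :=
  MonoidAlgebra.lift K _ G (MonoidAlgebra.of L G)

variable {K L G H : Type*} [Field K] [Field L] [Algebra K L] [Group G] [Group H]

theorem extendScalars_single (g : G) (c : K) :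
    extendScalars K L G (MonoidAlgebra.single g c) =
      MonoidAlgebra.single g (algebraMap K L c) := by
  simp [extendScalars, Algebra.algebraMap_eq_smul_one]

theorem coeff_extendScalars (f : MonoidAlgebra K G) (g : G) :
    (extendScalars K L G f).coeff g = algebraMap K L (f.coeff g) := by
  classical
  induction f using MonoidAlgebra.induction_linear with
  | zero => simp
  | add f f' hf hf' => simp [hf, hf']
  | single k c =>
    rw [extendScalars_single, MonoidAlgebra.coeff_single, MonoidAlgebra.coeff_single,
      Finsupp.single_apply, Finsupp.single_apply]
    split_ifs <;> simp

theorem extendScalars_injective : Function.Injective (extendScalars K L G) := by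
  rw [injective_iff_map_eq_zero]
  intro f hf
  ext g
  have := coeff_extendScalars (L := L) f g
  rw [hf] at this
  exact (map_eq_zero (algebraMap K L)).1 this.symm

variable {V : Type*} [AddCommGroup V] [Module L V]

/-- A representation whose kernel contains `ker λ` kills the kernel of `KG → KH`. -/
theorem asAlgebraHom_extendScalars_eq_zero (ρ : Representation L G V) {lam : G →* H}
    (hker : lam.ker ≤ MonoidHom.ker ρ) {f : MonoidAlgebra K G}
    (hf : MonoidAlgebra.mapDomainAlgHom K K lam f = 0) :
    ρ.asAlgebraHom (extendScalars K L G f) = 0 := by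
  have hfac : Function.FactorsThrough ρ lam := by
    intro g k hgk
    have : ρ (g⁻¹ * k) = 1 := hker (by rw [MonoidHom.mem_ker, map_mul, map_inv, hgk, inv_mul_cancel])
    calc ρ g = ρ g * ρ (g⁻¹ * k) := by rw [this, mul_one]
      _ = ρ k := by rw [← map_mul, mul_inv_cancel_left]
  -- ρ factors through the image of λ. Only a linear map on LH is needed, so values off the image
  -- may be set to 0.
  have key : ∀ f : MonoidAlgebra K G, ρ.asAlgebraHom (extendScalars K L G f) =
      Finsupp.linearCombination L (Function.extend lam ρ 0)
        (extendScalars K L H (MonoidAlgebra.mapDomainAlgHom K K lam f)).coeff := by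
    intro f
    induction f using MonoidAlgebra.induction_linear with
    | zero => simp
    | add f f' hf hf' => simp only [map_add, MonoidAlgebra.coeff_add, hf, hf']
    | single k c => simp [extendScalars_single, hfac.extend_apply]
  simp [key, hf]

/-- The sum of a normal subgroup acts as zero in an irreducible representation unless the subgroup
acts trivially. -/
theorem sum_apply_eq_zero_of_irreducible (ρ : Representation L G V) (hρ : ρ.IsIrreducible)
    (N : Subgroup G) [N.Normal] [Fintype N] (hN : ¬ N ≤ MonoidHom.ker ρ) :
    ∑ n : N, ρ n = 0 := by
  -- The N-fixed vectors form a subrepresentation by normality. It is not everything, hence it is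
  -- zero, and it contains the image of the sum over N.
  let W : Subrepresentation ρ :=
    { toSubmodule :=
        { carrier := {v | ∀ n ∈ N, ρ n v = v}
          add_mem' := fun hv hw n hn => by rw [map_add, hv n hn, hw n hn]
          zero_mem' := fun n _ => map_zero _
          smul_mem' := fun c v hv n hn => by rw [map_smul, hv n hn] }
      apply_mem_toSubmodule := by
        intro g v hv n hn
        have h := hv (g⁻¹ * n * g) (by
          simpa using Subgroup.Normal.conj_mem inferInstance n hn g⁻¹)
        calc ρ n (ρ g v) = ρ g (ρ (g⁻¹ * n * g) v) := by
              rw [← Module.End.mul_apply, ← Module.End.mul_apply, ← map_mul, ← map_mul]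
              congr 2
              group
          _ = ρ g v := by rw [h] }
  have hmem : ∀ v, v ∈ W ↔ ∀ n ∈ N, ρ n v = v := fun v => Iff.rfl
  have hW : W = ⊥ := by
    refine (hρ.eq_bot_or_eq_top W).resolve_right fun hW => hN fun n hn => ?_
    rw [MonoidHom.mem_ker]
    ext v
    have : v ∈ W := hW ▸ trivial
    exact (hmem v).1 this n hn
  ext v
  have hv : (∑ n : N, ρ n) v ∈ W := by
    rw [hmem]
    intro m hm
    rw [← Module.End.mul_apply, Finset.mul_sum]
    congr 1
    rw [← Equiv.sum_comp (Equiv.mulLeft (⟨m, hm⟩ : N)) fun n : N => ρ n]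
    simp
  rw [hW] at hv
  exact hv

theorem smul_eq_zero_of_irreducible {L : Type u} [Field L] {f : MonoidAlgebra L G}
    (h : ∀ (V : Type u) [AddCommGroup V] [Module L V] (ρ : Representation L G V),
      ρ.IsIrreducible → ρ.asAlgebraHom f = 0)
    {M : Type u} [AddCommGroup M] [Module (MonoidAlgebra L G) M]
    [hM : IsSimpleModule (MonoidAlgebra L G) M] (m : M) : f • m = 0 := by
  have h0 : (Representation.ofModule (k := L) (G := G) M).asAlgebraHom f = 0 :=
    @h (RestrictScalars L (MonoidAlgebra L G) M) inferInstance
    (RestrictScalars.module L (MonoidAlgebra L G) M) (Representation.ofModule M)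
    ((Representation.isSimpleModule_iff_irreducible_ofModule M).1 hM)
  have h1 := Representation.ofModule_asAlgebraHom_apply_apply M f
    ((RestrictScalars.addEquiv L (MonoidAlgebra L G) M).symm m)
  rw [h0, AddEquiv.apply_symm_apply] at h1
  exact (RestrictScalars.addEquiv L (MonoidAlgebra L G) M).symm.injective
    (h1.symm.trans (map_zero _).symm)

/-- An element of a group algebra in a semisimple situation vanishes if it acts as zero in all
irreducible representations in a given universe. -/
theorem eq_zero_of_irreducible {L : Type u} [Field L] [Finite G] [NeZero (Nat.card G : L)]
    {f : MonoidAlgebra L G}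
    (h : ∀ (V : Type u) [AddCommGroup V] [Module L V] (ρ : Representation L G V),
      ρ.IsIrreducible → ρ.asAlgebraHom f = 0) : f = 0 := by
  -- G may live in another universe; smallness moves the simple quotients of LG into the universe of
  -- the hypothesis.
  have hsmall : Small.{u} (MonoidAlgebra L G) :=
    small_of_injective (β := G → L) (f := fun f => ⇑f.coeff)
      (DFunLike.coe_injective.comp MonoidAlgebra.coeff_injective)
  -- Acting as zero on the class of 1 in LG/m puts f in each maximal left ideal m. By Maschke the
  -- Jacobson radical is zero.
  have hj : f ∈ Ring.jacobson (MonoidAlgebra L G) := by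
    rw [Ring.jacobson, Module.jacobson, Submodule.mem_sInf]
    intro m hm
    have : Small.{u} (MonoidAlgebra L G ⧸ m) :=
      small_of_surjective (Submodule.Quotient.mk_surjective m)
    have hs : IsSimpleModule (MonoidAlgebra L G) (MonoidAlgebra L G ⧸ m) :=
      isSimpleModule_iff_isCoatom.2 hm
    have hs' : IsSimpleModule (MonoidAlgebra L G) (Shrink.{u} (MonoidAlgebra L G ⧸ m)) :=
      IsSimpleModule.congr (Shrink.linearEquiv (MonoidAlgebra L G) (MonoidAlgebra L G ⧸ m))
    have h2 := smul_eq_zero_of_irreducible h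
      ((Shrink.linearEquiv (MonoidAlgebra L G) (MonoidAlgebra L G ⧸ m)).symm
        (Submodule.Quotient.mk 1))
    rw [← map_smul, ← Submodule.Quotient.mk_smul, smul_eq_mul, mul_one,
      LinearEquiv.map_eq_zero_iff, Submodule.Quotient.mk_eq_zero] at h2
    exact h2
  rwa [IsSemisimpleRing.jacobson_eq_bot, Submodule.mem_bot] at hj

end Representation

/-! ### Criteria for simplicity -/

section Criteria

variable {G H X : Type*} [Group G] [Finite G] [Group H]
  {Φ : X → MulAut G ⊕ (G →* H)}

theorem kerIdeal_eq_bot_of_irreducible {K : Type u} [Field K] (hK : (Nat.card G : K) ≠ 0)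
    (h : ∀ (V : Type u) [AddCommGroup V] [Module (AlgebraicClosure K) V]
      (ρ : Representation (AlgebraicClosure K) G V), ρ.IsIrreducible →
      ∃ lam ∈ homSet Φ, MonoidHom.ker lam ≤ MonoidHom.ker ρ) : kerIdeal Φ K = ⊥ := by
  have : NeZero (Nat.card G : AlgebraicClosure K) := ⟨by
    rw [← map_natCast (algebraMap K (AlgebraicClosure K))]
    exact (map_ne_zero _).2 hK⟩
  rw [eq_bot_iff]
  intro f hf
  rw [Submodule.mem_bot]
  apply extendScalars_injective (L := AlgebraicClosure K)
  rw [map_zero]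
  refine eq_zero_of_irreducible fun V _ _ ρ hρ => ?_
  obtain ⟨lam, hl, hker⟩ := h V ρ hρ
  exact asAlgebraHom_extendScalars_eq_zero ρ hker (mem_kerIdeal.1 hf lam hl)

/-- For each λ, the element z(λ) = |ker λ| − Σ n, with n running over ker λ, is killed in KH. If no
ker λ is contained in ker ρ, then ρ sends z(λ) to the nonzero scalar |ker λ|. The product of all
z(λ) lies in `kerIdeal` = 0, yet ρ maps it to a nonzero scalar. -/
theorem exists_ker_le_of_kerIdeal_eq_bot [Finite H] {K L V : Type*} [Field K] [Field L]
    [Algebra K L] [AddCommGroup V] [Module L V] (hK : (Nat.card G : K) ≠ 0) (h : kerIdeal Φ K = ⊥)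
    (ρ : Representation L G V) (hρ : ρ.IsIrreducible) :
    ∃ lam ∈ homSet Φ, MonoidHom.ker lam ≤ MonoidHom.ker ρ := by
  classical
  by_contra! hcon
  have := Fintype.ofFinite G
  have : Finite (G →* H) := Finite.of_injective _ DFunLike.coe_injective
  let z : (G →* H) → MonoidAlgebra K G := fun lam =>
    algebraMap K _ (Nat.card lam.ker : K) - ∑ n : lam.ker, MonoidAlgebra.single (n : G) 1
  have hz : ∀ lam, MonoidAlgebra.mapDomainAlgHom K K lam (z lam) = 0 := by
    intro lam
    have : ∀ n : lam.ker, lam n = 1 := fun n => n.2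
    simp only [z, map_sub, map_sum, AlgHom.commutes, MonoidAlgebra.mapDomainAlgHom_apply,
      MonoidAlgebra.mapDomain_single, this, ← MonoidAlgebra.one_def]
    simp
  have hcard : ∀ lam : G →* H, (Nat.card lam.ker : K) ≠ 0 := by
    intro lam h0
    obtain ⟨d, hd⟩ := lam.ker.card_subgroup_dvd_card
    exact hK (by rw [hd, Nat.cast_mul, h0, zero_mul])
  have hρz : ∀ lam ∈ homSet Φ, ρ.asAlgebraHom (extendScalars K L G (z lam)) =
      algebraMap L _ (algebraMap K L (Nat.card lam.ker : K)) := by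
    intro lam hl
    have h0 := sum_apply_eq_zero_of_irreducible ρ hρ lam.ker (hcon lam hl)
    simp only [z, map_sub, map_sum, extendScalars_single, Representation.asAlgebraHom_single,
      map_one, one_smul, h0, sub_zero]
    simp
  let l := (Set.toFinite (homSet Φ)).toFinset.toList
  have hmem : ∀ lam, lam ∈ l ↔ lam ∈ homSet Φ := fun lam => by simp [l]
  have hprod : (l.map z).prod = 0 := by
    have : (l.map z).prod ∈ kerIdeal Φ K := by
      rw [mem_kerIdeal]
      intro lam hl
      rw [map_list_prod, List.map_map]
      exact List.prod_eq_zero (List.mem_map.2 ⟨lam, (hmem lam).2 hl, hz lam⟩)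
    rwa [h, Submodule.mem_bot] at this
  have hne : ∀ l' : List (G →* H), (∀ lam ∈ l', lam ∈ homSet Φ) →
      ∃ c : L, c ≠ 0 ∧ ρ.asAlgebraHom (extendScalars K L G (l'.map z).prod) = algebraMap L _ c := by
    intro l' hl'
    induction l' with
    | nil => exact ⟨1, one_ne_zero, by simp⟩
    | cons lam l' ih =>
      obtain ⟨c, hc, e⟩ := ih fun k hk => hl' k (List.mem_cons_of_mem _ hk)
      refine ⟨algebraMap K L (Nat.card lam.ker : K) * c,
        mul_ne_zero ((map_ne_zero _).2 (hcard lam)) hc, ?_⟩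
      rw [List.map_cons, List.prod_cons, map_mul, map_mul, e, hρz lam (hl' lam (by simp)), map_mul]
  obtain ⟨c, hc, e⟩ := hne l fun lam => (hmem lam).1
  rw [hprod, map_zero, map_zero] at e
  have hV : Nontrivial V := by
    by_contra hV
    rw [not_nontrivial_iff_subsingleton] at hV
    refine bot_ne_top (α := Subrepresentation ρ) (SetLike.ext fun v => ?_)
    rw [Subsingleton.elim v 0]
    exact ⟨fun _ => trivial, fun _ => rfl⟩
  exact hc ((map_eq_zero_iff _ (algebraMap L (Module.End L V)).injective).1 e.symm)

/-- The sum of all elements of G is invariant under automorphisms, and μ sends it to |ker μ| times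
the sum over its image, which is zero in K. -/
theorem kerIdeal_ne_bot_of_dvd {K : Type*} [Field K]
    (h : ∀ (x : X) (lam : G →* H), Φ x = Sum.inr lam → (Nat.card (MonoidHom.ker lam) : K) = 0) :
    kerIdeal Φ K ≠ ⊥ := by
  classical
  have := Fintype.ofFinite G
  intro hbot
  let f : MonoidAlgebra K G := ∑ g : G, MonoidAlgebra.single g 1
  have hf : f ∈ kerIdeal Φ K := by
    rw [mem_kerIdeal]
    rintro _ ⟨x, μ, α, -, hx, rfl⟩
    have hα : MonoidAlgebra.mapDomainAlgHom K K (α : G ≃* G).toMonoidHom f = f := by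
      simp only [f, map_sum, MonoidAlgebra.mapDomainAlgHom_apply, MonoidAlgebra.mapDomain_single]
      exact Equiv.sum_comp (α : G ≃* G).toEquiv fun g => MonoidAlgebra.single g (1 : K)
    rw [MonoidAlgebra.mapDomainAlgHom_comp, AlgHom.comp_apply, hα]
    ext k
    have hsum : (MonoidAlgebra.mapDomainAlgHom K K μ f).coeff k =
        ((Finset.univ.filter fun g => μ g = k).card : K) := by
      simp [f, MonoidAlgebra.mapDomainAlgHom_apply, Finsupp.single_apply]
    rw [hsum, MonoidAlgebra.coeff_zero, Finsupp.zero_apply]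
    by_cases hk : k ∈ Set.range μ
    · rw [MonoidHom.card_fiber_eq_of_mem_range μ hk ⟨1, map_one μ⟩, ← h x μ hx,
        Nat.card_eq_fintype_card, Fintype.card_subtype]
      simp only [MonoidHom.mem_ker]
    · rw [Finset.filter_eq_empty_iff.2 fun g _ e => hk ⟨g, e⟩]
      simp
  rw [hbot, Submodule.mem_bot] at hf
  have := congrArg (fun f => f.coeff 1) hf
  simp [f, Finsupp.single_apply] at this

end Criteria

end Multispinal

theorem theoremt {G H X : Type*} [Group G] [Finite G] [Group H] [Finite H] [Fintype X]
    [MulAction H X] (hfree : ∀ (h : H) (x : X), h • x = x → h = 1)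
    (Φ : X → MulAut G ⊕ (G →* H)) (hΦ : Multispinal.IsMultispinal Φ)
    (K : Type u) [Field K] :
    (IsSimpleRing (Multispinal.NekrashevychAlgebra K (Multispinal.multispinalGroup Φ) X) ↔
      ⨅ lam ∈ Multispinal.homSet Φ,
        RingHom.ker (MonoidAlgebra.mapDomainAlgHom K K lam :
          MonoidAlgebra K G →ₐ[K] MonoidAlgebra K H) = ⊥) ∧
    (¬ ringChar K ∣ Nat.card G →
      (IsSimpleRing (Multispinal.NekrashevychAlgebra K (Multispinal.multispinalGroup Φ) X) ↔
        ∀ (V : Type u) [AddCommGroup V] [Module (AlgebraicClosure K) V]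
          (ρ : Representation (AlgebraicClosure K) G V), ρ.IsIrreducible →
          ∃ lam ∈ Multispinal.homSet Φ, MonoidHom.ker lam ≤ MonoidHom.ker ρ)) ∧
    ((∀ (x : X) (lam : G →* H), Φ x = Sum.inr lam →
        ringChar K ∣ Nat.card (MonoidHom.ker lam)) →
      ¬ IsSimpleRing (Multispinal.NekrashevychAlgebra K (Multispinal.multispinalGroup Φ) X)) := by
  have main : IsSimpleRing
      (Multispinal.NekrashevychAlgebra K (Multispinal.multispinalGroup Φ) X) ↔
      Multispinal.kerIdeal Φ K = ⊥ :=
    ⟨Multispinal.kerIdeal_eq_bot_of_isSimpleRing hfree hΦ,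
      Multispinal.isSimpleRing_of_kerIdeal_eq_bot hfree hΦ⟩
  refine ⟨main, fun hK => ?_, fun hK => ?_⟩
  · rw [← ringChar.spec] at hK
    rw [main]
    exact ⟨fun h V _ _ ρ hρ => Multispinal.exists_ker_le_of_kerIdeal_eq_bot hK h ρ hρ,
      Multispinal.kerIdeal_eq_bot_of_irreducible hK⟩
  · rw [main]
    exact Multispinal.kerIdeal_ne_bot_of_dvd fun x lam hx => (ringChar.spec K _).2 (hK x lam hx)
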